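/- Let $n\ge 0$ and let $f:\mathbb{R}^n\to[0,\infty)$ be smooth ($C^\infty$) and bounded. (a) Let $R>0$ and let $d\mu=e^{-U(x)}\,dx$ be a probability measure on $\mathbb{R}^n$ such that $U$ is smooth and $\mathrm{Hess}\,U(x)\ge R\cdot \mathrm{Id}$ for all $x$. Then $$\int_{\mathbb{R}^n}\frac{1}{\sqrt2}\Bigl(2f-\sqrt{f^2+\tfrac{\|\nabla f\|^2}{R}}\Bigr)\sqrt{f+\sqrt{f^2+\tfrac{\|\nabla f\|^2}{R}}}\;d\mu\;\le\;\Bigl(\int_{\mathbb{R}^n} f\,d\mu\Bigr)^{3/2},$$ where the positive part of the integrand on the left has finite integral, so that the left-hand side is well defined in $[-\infty,\infty)$. (b) For the standard Gaussian measure $d\gamma=(2\pi)^{-n/2}e^{-\|x\|^2/2}\,dx$, $$\int_{\mathbb{R}^n} f^{3/2}\,d\gamma-\Bigl(\int_{\mathbb{R}^n} f\,d\gamma\Bigr)^{3/2}\le\int_{\mathbb{R}^n}\Bigl(f^{3/2}-\frac{1}{\sqrt2}\bigl(2f-\sqrt{f^2+\|\nabla f\|^2}\bigr)\sqrt{f+\sqrt{f^2+\|\nabla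 f\|^2}}\Bigr)d\gamma ,$$ where the integrand on the right is nonnegative and the right-hand side is a value in $[0,\infty]$. (c) The bound in (b) improves Beckner's inequality $\int f^{3/2}d\gamma-(\int f\,d\gamma)^{3/2}\le\frac38\int f^{-1/2}\|\nabla f\|^2d\gamma$ (the case $p=3/2$): the right-hand side in (b) is at most $\frac38\int_{\mathbb{R}^n} f^{-1/2}\|\nabla f\|^2\,d\gamma\in[0,\infty]$. Moreover, pointwise, for all real $x,y\ge0$, $$x^{3/2}-\frac{1}{\sqrt2}\bigl(2x-\sqrt{x^2+y^2}\bigr)\sqrt{x+\sqrt{x^2+y^2}}\;\le\;\frac38\,x^{-1/2}y^2,$$ with strict inequality if $y\neq0$. Here $x^{-1/2}y^2$ is read as $0$ if $y=0$ and as $+\infty$ if $x=0<y$. -/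

import Mathlib

open MeasureTheory
open scoped ENNReal ContDiff

noncomputable section

/-- The measure `e^{-U(x)} dx` on `ℝⁿ`. -/
def expNegMeasure {n : ℕ} (U : EuclideanSpace ℝ (Fin n) → ℝ) :
    Measure (EuclideanSpace ℝ (Fin n)) :=
  volume.withDensity fun x => ENNReal.ofReal (Real.exp (-U x))

/-- The standard Gaussian measure `(2π)^{-n/2} e^{-|x|²/2} dx` on `ℝⁿ`. -/
def gaussianMeasure (n : ℕ) : Measure (EuclideanSpace ℝ (Fin n)) :=
  volume.withDensity fun x =>
    ENNReal.ofReal (1 / Real.sqrt ((2 * Real.pi) ^ n) * Real.exp (-‖x‖ ^ 2 / 2))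

/-- `gaussianMeasure n` is Mathlib's standard Gaussian measure. -/
theorem gaussianMeasure_eq_stdGaussian (n : ℕ) :
    gaussianMeasure n = ProbabilityTheory.stdGaussian (EuclideanSpace ℝ (Fin n)) := by
  set c : ℝ := Real.sqrt ((2 * Real.pi) ^ n) with hc
  have hc0 : 0 < c := by positivity
  have hd : Measurable fun x : EuclideanSpace ℝ (Fin n) =>
      ENNReal.ofReal (1 / c * Real.exp (-‖x‖ ^ 2 / 2)) := by fun_prop
  have hb : 0 < ((1 / 2 : ℝ) : ℂ).re := by norm_num
  have hnn : ∀ x : EuclideanSpace ℝ (Fin n), 0 ≤ 1 / c * Real.exp (-‖x‖ ^ 2 / 2) :=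
    fun x => by positivity
  have hi : Integrable fun x : EuclideanSpace ℝ (Fin n) =>
      1 / c * Real.exp (-‖x‖ ^ 2 / 2) := by
    have h := (GaussianFourier.integrable_cexp_neg_mul_sq_norm_add hb 0
      (0 : EuclideanSpace ℝ (Fin n))).norm.const_mul (1 / c)
    refine h.congr (Filter.Eventually.of_forall fun x => ?_)
    have : (-((1 / 2 : ℝ) : ℂ) * (‖x‖ : ℂ) ^ 2).re = -‖x‖ ^ 2 / 2 := by
      rw [← Complex.ofReal_neg, ← Complex.ofReal_pow, ← Complex.ofReal_mul, Complex.ofReal_re]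
      ring
    simp only [zero_mul, add_zero, Complex.norm_exp, this]
  have : IsFiniteMeasure (gaussianMeasure n) := by
    refine isFiniteMeasure_withDensity ?_
    exact hi.lintegral_lt_top.ne
  refine Measure.ext_of_charFun (funext fun t => ?_)
  rw [ProbabilityTheory.charFun_stdGaussian, charFun_apply, gaussianMeasure,
    integral_withDensity_eq_integral_toReal_smul hd
      (Filter.Eventually.of_forall fun _ => ENNReal.ofReal_lt_top)]
  have h := GaussianFourier.integral_cexp_neg_mul_sq_norm_add hb Complex.I t
  have e : ∀ x : EuclideanSpace ℝ (Fin n),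
      (ENNReal.ofReal (1 / c * Real.exp (-‖x‖ ^ 2 / 2))).toReal •
        Complex.exp ((inner ℝ x t : ℝ) * Complex.I) =
      (1 / c : ℂ) * Complex.exp (-((1 / 2 : ℝ) : ℂ) * (‖x‖ : ℂ) ^ 2 +
        Complex.I * (inner ℝ t x : ℝ)) := by
    intro x
    rw [ENNReal.toReal_ofReal (hnn x), real_inner_comm, Complex.exp_add, Complex.real_smul]
    push_cast
    rw [mul_assoc]
    congr 3
    · ring_nf
    · ring_nf
  simp_rw [e]
  rw [integral_const_mul, h]
  have hpow : ((Real.pi : ℂ) / ((1 / 2 : ℝ) : ℂ)) ^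
      ((Module.finrank ℝ (EuclideanSpace ℝ (Fin n)) : ℂ) / 2) = (c : ℂ) := by
    rw [finrank_euclideanSpace_fin, hc, Real.sqrt_eq_rpow, ← Real.rpow_natCast,
      ← Real.rpow_mul (by positivity), Complex.ofReal_cpow (by positivity)]
    push_cast
    congr 1 <;> ring
  rw [hpow, ← mul_assoc, one_div, inv_mul_cancel₀ (by exact_mod_cast hc0.ne'), one_mul]
  congr 1
  rw [Complex.I_sq]
  push_cast
  ring

/-- `Hess U(x) ≥ R · Id` at every point `x`, as quadratic forms. -/
def HessianGE {n : ℕ} (U : EuclideanSpace ℝ (Fin n) → ℝ) (R : ℝ) : Prop :=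
  ∀ x v : EuclideanSpace ℝ (Fin n), R * ‖v‖ ^ 2 ≤ fderiv ℝ (fderiv ℝ U) x v v

/-- The function `(1/√2) (2x - √(x² + z)) √(x + √(x² + z))`, in which `z` stands for the square of
the (rescaled) length of the gradient. -/
def threeHalves (x z : ℝ) : ℝ :=
  1 / Real.sqrt 2 * (2 * x - Real.sqrt (x ^ 2 + z)) * Real.sqrt (x + Real.sqrt (x ^ 2 + z))

/-- The integrand `(3/8) x^{-1/2} y²` on the right-hand side of Beckner's inequality for `p = 3/2`,
with values in `[0, ∞]`; it is `0` if `y = 0` and `∞` if `x = 0 < y`. -/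
def becknerIntegrand (x y : ℝ) : ℝ≥0∞ :=
  ENNReal.ofReal (3 / 8) * ENNReal.ofReal x ^ (-(1 / 2) : ℝ) * ENNReal.ofReal (y ^ 2)

/-- The integral `∫ g⁺ dμ - ∫ g⁻ dμ ∈ [-∞, ∞]` of a real function; to be used only if one of the
two terms is finite. -/
def extIntegral {α : Type*} [MeasurableSpace α] (μ : Measure α) (g : α → ℝ) : EReal :=
  ((∫⁻ x, ENNReal.ofReal (g x) ∂μ : ℝ≥0∞) : EReal) -
    ((∫⁻ x, ENNReal.ofReal (-g x) ∂μ : ℝ≥0∞) : EReal)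

/-- For integrable functions, `extIntegral` is the usual integral. -/
theorem extIntegral_eq_integral {α : Type*} [MeasurableSpace α] {μ : Measure α} {g : α → ℝ}
    (hg : Integrable g μ) : extIntegral μ g = ((∫ x, g x ∂μ : ℝ) : EReal) := by
  have h1 : ∫⁻ x, ENNReal.ofReal (g x) ∂μ ≠ ⊤ := hg.lintegral_lt_top.ne
  have h2 : ∫⁻ x, ENNReal.ofReal (-g x) ∂μ ≠ ⊤ := hg.neg.lintegral_lt_top.ne
  rw [integral_eq_lintegral_pos_part_sub_lintegral_neg_part hg, EReal.coe_sub,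
    EReal.coe_ennreal_toReal h1, EReal.coe_ennreal_toReal h2]
  rfl

end

open ProbabilityTheory Filter Topology Set

/-! The inequality is linearized by Legendre duality. For `x, z ≥ 0` the number `threeHalves x z` is
the supremum over `g > 0` of `3/2 * (x g - g³/3 - z/(4g))`, and `m^(3/2)` is the supremum over `G ≥
0` of `3/2 * (m G - G³/3)`. So (a) follows from the dual inequality `∫ (f g - g³/3 - |∇f|²/(4 R g))
dμ ≤ (∫ f)(∫ g) - (∫ g)³/3` for positive functions `g` (`DualInequality` with all weights `1/R`).

On the Gaussian line (`gaussianReal_covariance_bound`), let `m = ∫ g` and let `ξ` be the bounded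
solution of Stein's equation `ξ' = x ξ - (g - m)`. Then `∫ u (g - m) = ∫ u' ξ`, and a second
integration by parts gives `∫ g³/3 - m³/3 = ∫ g ξ² + ∫ ξ'² (g + 2ξ'/3)`. Since `u' ξ ≤ u'²/(4g) + g
ξ²`, it remains to see that the last integral is nonnegative. This holds because `3g + 2ξ' = g + 2(m
+ x ξ)`, while `g > 0` and Mills' ratio gives `x ξ ≥ -m`.

The dual inequality survives convolution, with addition of the weights (`DualInequality.conv`),
images under `θ`-Lipschitz maps, with the factor `θ²` (`DualInequality.map`), and weak limits
(`DualInequality.of_tendsto`). Convolving the coordinate axes gives the standard Gaussian in `ℝⁿ`.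
For `e^{-U}` with `Hess U ≥ R`, a discretized Langevin dynamics started at a Dirac mass alternates
Gaussian noise with gradient steps that contract by `1 - hR`; this never raises the weights above
`1/R`, and its laws approach `e^{-U}`. The dynamics is run only for quadratic plus log-sum-exp
potentials; these approximate the general `U`, since `U - R|x|²/2` is a supremum of affine
functions.

The passage back to the primal inequality optimizes `g` pointwise and removes the bound on the
gradient by cutoffs. Part (b) is the Gaussian case subtracted from `∫ f^(3/2)`, and (c) is a
polynomial inequality in `√x` and the optimal `g`. -/

/-! ### Stein's equation and the dual inequality for the Gaussian measure on the line. -/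

theorem integrable_exp_neg_sq_half : Integrable fun x : ℝ => Real.exp (-x ^ 2 / 2) := by
  have h := integrable_exp_neg_mul_sq (b := 1 / 2) (by norm_num)
  refine h.congr (Eventually.of_forall fun x => ?_)
  ring_nf

theorem hasDerivAt_exp_neg_sq_half (x : ℝ) :
    HasDerivAt (fun x : ℝ => Real.exp (-x ^ 2 / 2)) (-x * Real.exp (-x ^ 2 / 2)) x := by
  have h : HasDerivAt (fun x : ℝ => -x ^ 2 / 2) (-x) x := by
    refine ((hasDerivAt_pow 2 x).fun_neg.div_const 2).congr_deriv ?_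
    norm_num
    ring
  have := h.exp
  rwa [mul_comm] at this

theorem tendsto_exp_neg_sq_half_atTop :
    Tendsto (fun x : ℝ => Real.exp (-x ^ 2 / 2)) atTop (𝓝 0) := by
  refine Real.tendsto_exp_atBot.comp ?_
  have : Tendsto (fun x : ℝ => x ^ 2 / 2) atTop atTop :=
    (tendsto_pow_atTop (by norm_num)).atTop_div_const (by norm_num)
  refine (tendsto_neg_atTop_atBot.comp this).congr fun x => ?_
  simp [neg_div]

theorem tendsto_exp_neg_sq_half_atBot :
    Tendsto (fun x : ℝ => Real.exp (-x ^ 2 / 2)) atBot (𝓝 0) := by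
  have := tendsto_exp_neg_sq_half_atTop.comp tendsto_neg_atBot_atTop
  refine this.congr fun x => ?_
  simp

theorem integrable_mul_exp_neg_sq_half :
    Integrable fun x : ℝ => x * Real.exp (-x ^ 2 / 2) := by
  have h := integrable_mul_exp_neg_mul_sq (b := 1 / 2) (by norm_num)
  refine h.congr (Eventually.of_forall fun x => ?_)
  simp only
  ring_nf

theorem integral_Ioi_mul_exp_neg_sq_half (x : ℝ) :
    ∫ t in Ioi x, t * Real.exp (-t ^ 2 / 2) = Real.exp (-x ^ 2 / 2) := by
  have h := integral_Ioi_of_hasDerivAt_of_tendsto (a := x)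
    (f := fun t => -Real.exp (-t ^ 2 / 2)) (f' := fun t => t * Real.exp (-t ^ 2 / 2)) (m := 0)
    (by fun_prop) (fun t _ => (hasDerivAt_exp_neg_sq_half t).fun_neg.congr_deriv (by ring))
    integrable_mul_exp_neg_sq_half.integrableOn
    (by simpa using tendsto_exp_neg_sq_half_atTop.neg)
  rw [h]; ring

theorem integrable_bdd_mul_exp_neg_sq_half {k : ℝ → ℝ} (hk : Continuous k) {B : ℝ}
    (hB : ∀ x, |k x| ≤ B) : Integrable fun t => k t * Real.exp (-t ^ 2 / 2) :=
  integrable_exp_neg_sq_half.bdd_mul (c := B) hk.aestronglyMeasurable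
    (Eventually.of_forall fun x => by simpa using hB x)

/-- A form of the bound on Mills' ratio. -/
theorem neg_le_mul_integral_Ioi {k : ℝ → ℝ} (hk : Continuous k) {B : ℝ}
    (hB : ∀ x, |k x| ≤ B) {m : ℝ} (hm : 0 ≤ m) (hkm : ∀ x, -m ≤ k x) {x : ℝ} (hx : 0 ≤ x) :
    -m * Real.exp (-x ^ 2 / 2) ≤ x * ∫ t in Ioi x, k t * Real.exp (-t ^ 2 / 2) := by
  -- With `e^{-x²/2}` written as `∫_{t > x} t e^{-t²/2}`, the claim is pointwise: `x k(t) ≥ -m x ≥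
  -- -m t`.
  rw [← integral_Ioi_mul_exp_neg_sq_half x, ← integral_const_mul, ← integral_const_mul]
  refine setIntegral_mono_on (integrable_mul_exp_neg_sq_half.const_mul _).integrableOn
    ((integrable_bdd_mul_exp_neg_sq_half hk hB).const_mul _).integrableOn measurableSet_Ioi
    fun t ht => ?_
  have ht : x < t := ht
  rw [← mul_assoc, ← mul_assoc]
  refine mul_le_mul_of_nonneg_right ?_ (Real.exp_pos _).le
  nlinarith [hkm t]

/-- Bounded solutions of Stein's equation `ξ' = x ξ - k`. -/
theorem exists_stein_solution {k : ℝ → ℝ} (hk : Continuous k) {B : ℝ} (hB : ∀ x, |k x| ≤ B)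
    (hmean : ∫ x, k x * Real.exp (-x ^ 2 / 2) = 0) :
    ∃ ξ : ℝ → ℝ, (∀ x, HasDerivAt ξ (x * ξ x - k x) x) ∧
      (∃ C, ∀ x, |ξ x| ≤ C ∧ |x * ξ x| ≤ C) ∧
      ∀ m, 0 ≤ m → (∀ x, -m ≤ k x) → ∀ x, -m ≤ x * ξ x := by
  set w : ℝ → ℝ := fun t => k t * Real.exp (-t ^ 2 / 2) with hw
  have hwi : Integrable w := integrable_bdd_mul_exp_neg_sq_half hk hB
  have hwc : Continuous w := by fun_prop
  have key : ∀ k' : ℝ → ℝ, Continuous k' → (∀ x, |k' x| ≤ B) →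
      (∫ x, k' x * Real.exp (-x ^ 2 / 2) = 0) → ∀ m, 0 ≤ m → (∀ x, -m ≤ k' x) → ∀ x,
      -m * Real.exp (-x ^ 2 / 2) ≤ x * ∫ t in Ioi x, k' t * Real.exp (-t ^ 2 / 2) := by
    intro k' hk' hB' hmean' m hm hkm x
    rcases le_total 0 x with hx | hx
    · exact neg_le_mul_integral_Ioi hk' hB' hm hkm hx
    -- For `x ≤ 0`, reflect; the mean-zero condition turns the integral over the left tail into
    -- minus the one over the right tail.
    · have h1 := neg_le_mul_integral_Ioi (k := fun t => k' (-t)) (by fun_prop)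
        (fun t => hB' (-t)) hm (fun t => hkm (-t)) (x := -x) (by linarith)
      have h2 := integral_comp_neg_Ioi (-x) (fun t => k' t * Real.exp (-t ^ 2 / 2))
      have h3 := intervalIntegral.integral_Iic_add_Ioi (b := x)
        (integrable_bdd_mul_exp_neg_sq_half hk' hB').integrableOn
        (integrable_bdd_mul_exp_neg_sq_half hk' hB').integrableOn
      simp only [neg_sq, neg_neg] at h1 h2
      rw [h2] at h1
      rw [hmean'] at h3
      have h4 : ∫ t in Iic x, k' t * Real.exp (-t ^ 2 / 2) =
        -∫ t in Ioi x, k' t * Real.exp (-t ^ 2 / 2) := by linarith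
      rw [h4] at h1
      linarith
  have hexp : ∀ x : ℝ, Real.exp (x ^ 2 / 2) * Real.exp (-x ^ 2 / 2) = 1 := by
    intro x
    rw [← Real.exp_add, ← Real.exp_zero]
    ring_nf
  -- Variation of constants from `+∞`; mean zero is what keeps this solution bounded at `-∞` as
  -- well.
  set ξ : ℝ → ℝ := fun x => Real.exp (x ^ 2 / 2) * ∫ t in Ioi x, w t with hξ
  have low : ∀ m, 0 ≤ m → (∀ x, -m ≤ k x) → ∀ x, -m ≤ x * ξ x := by
    intro m hm hkm x
    have h := mul_le_mul_of_nonneg_left (key k hk hB hmean m hm hkm x)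
      (Real.exp_pos (x ^ 2 / 2)).le
    have e := hexp x
    calc -m = Real.exp (x ^ 2 / 2) * (-m * Real.exp (-x ^ 2 / 2)) := by linear_combination (-m) * (-e)
      _ ≤ _ := h
      _ = x * ξ x := by simp only [hξ]; ring
  have hB0 : 0 ≤ B := (abs_nonneg _).trans (hB 0)
  have up : ∀ x, x * ξ x ≤ B := by
    intro x
    have h := mul_le_mul_of_nonneg_left (key (fun t => -k t) hk.neg (fun t => by simpa using hB t)
      (by simp only [neg_mul]; rw [integral_neg, hmean, neg_zero]) B hB0
      (fun t => by have := (abs_le.1 (hB t)).2; linarith) x)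
      (Real.exp_pos (x ^ 2 / 2)).le
    simp only [neg_mul] at h
    rw [integral_neg] at h
    have e := hexp x
    have : x * ξ x = Real.exp (x ^ 2 / 2) * (x * ∫ t in Ioi x, w t) := by simp only [hξ]; ring
    rw [this]
    simp only [hw]
    linear_combination h + B * e
  have hbd : ∀ x, |x * ξ x| ≤ B := fun x =>
    abs_le.2 ⟨low B hB0 (fun t => (abs_le.1 (hB t)).1) x, up x⟩
  -- For `|x| ≥ 1`, `|ξ| ≤ |x ξ| ≤ B`; for `|x| ≤ 1`, the prefactor of `ξ` is at most `exp (1/2)`.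
  refine ⟨ξ, ?_, ⟨max B (Real.exp (1 / 2) * ∫ t, |w t|), fun x => ⟨?_, ?_⟩⟩, low⟩
  · intro x
    have hint : ∀ x, ∫ t in Ioi x, w t = (∫ t in Ioi (0 : ℝ), w t) - ∫ t in (0 : ℝ)..x, w t := by
      intro x
      rw [intervalIntegral.integral_Ioi_sub_Ioi' hwi.integrableOn hwi.integrableOn |>.symm]
      ring
    have h1 : HasDerivAt (fun x => ∫ t in Ioi x, w t) (-w x) x := by
      rw [show (fun x => ∫ t in Ioi x, w t) =
        fun x => (∫ t in Ioi (0 : ℝ), w t) - ∫ t in (0 : ℝ)..x, w t from funext hint]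
      have := (intervalIntegral.integral_hasDerivAt_right (hwc.intervalIntegrable 0 x)
        (hwc.stronglyMeasurableAtFilter _ _) hwc.continuousAt).const_sub (∫ t in Ioi (0 : ℝ), w t)
      exact this
    have h2 : HasDerivAt (fun x : ℝ => Real.exp (x ^ 2 / 2)) (x * Real.exp (x ^ 2 / 2)) x := by
      have h : HasDerivAt (fun x : ℝ => x ^ 2 / 2) x x := by
        refine ((hasDerivAt_pow 2 x).div_const 2).congr_deriv ?_
        norm_num
      have := h.exp
      rwa [mul_comm] at this
    have := h2.mul h1
    refine this.congr_deriv ?_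
    have e := hexp x
    simp only [hξ, hw]
    linear_combination (-k x) * e
  · rcases le_total |x| 1 with hx | hx
    · refine le_trans ?_ (le_max_right _ _)
      simp only [hξ, abs_mul, Real.abs_exp]
      refine mul_le_mul ?_ ?_ (abs_nonneg _) (Real.exp_pos _).le
      · have : x ^ 2 ≤ 1 := by rw [← sq_abs]; nlinarith [abs_nonneg x]
        exact Real.exp_le_exp.2 (by linarith)
      · exact (abs_integral_le_integral_abs).trans
          (setIntegral_le_integral hwi.abs (Eventually.of_forall fun t => abs_nonneg _))
    · refine le_trans ?_ ((hbd x).trans (le_max_left _ _))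
      rw [abs_mul x]
      exact le_mul_of_one_le_left (abs_nonneg _) hx
  · exact (hbd x).trans (le_max_left _ _)

/-- The Gaussian divergence `x F - F'` has mean zero. -/
theorem integral_gaussian_divergence {F G : ℝ → ℝ} {C : ℝ}
    (hF : ∀ x, HasDerivAt F (x * F x - G x) x) (hFC : ∀ x, |F x| ≤ C) (hGC : ∀ x, |G x| ≤ C) :
    ∫ x, G x ∂(gaussianReal 0 1) = 0 := by
  rw [integral_gaussianReal_eq_integral_smul one_ne_zero]
  have hpdf : ∀ x : ℝ, gaussianPDFReal 0 1 x =
      (Real.sqrt (2 * Real.pi))⁻¹ * Real.exp (-x ^ 2 / 2) := by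
    intro x; simp [gaussianPDFReal]
  simp only [hpdf, smul_eq_mul, mul_assoc]
  rw [integral_const_mul]
  have hFc : Continuous F := continuous_iff_continuousAt.2 fun x => (hF x).continuousAt
  have hGm : Measurable G := by
    have : G = fun x => x * F x - deriv F x := by
      funext x; rw [(hF x).deriv]; ring
    rw [this]
    exact (measurable_id.mul hFc.measurable).sub (measurable_deriv F)
  have hlim : ∀ l : Filter ℝ, Tendsto (fun x : ℝ => Real.exp (-x ^ 2 / 2)) l (𝓝 0) →
      Tendsto (fun x => -(F x * Real.exp (-x ^ 2 / 2))) l (𝓝 0) := by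
    intro l hl
    have hl' := hl.const_mul C
    rw [mul_zero] at hl'
    refine squeeze_zero_norm (fun x => ?_) hl'
    rw [norm_neg, norm_mul, Real.norm_eq_abs, Real.norm_eq_abs, Real.abs_exp]
    exact mul_le_mul_of_nonneg_right (hFC x) (Real.exp_pos _).le
  have h := integral_of_hasDerivAt_of_tendsto
    (f := fun x => -(F x * Real.exp (-x ^ 2 / 2))) (f' := fun x => Real.exp (-x ^ 2 / 2) * G x)
    (m := 0) (n := 0) (fun x => by
      refine ((hF x).mul (hasDerivAt_exp_neg_sq_half x)).neg.congr_deriv ?_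
      ring)
    (by
      refine integrable_exp_neg_sq_half.mul_bdd (c := C) hGm.aestronglyMeasurable
        (Eventually.of_forall fun x => by simpa using hGC x))
    (hlim _ tendsto_exp_neg_sq_half_atBot) (hlim _ tendsto_exp_neg_sq_half_atTop)
  rw [h]; simp

/-- The dual inequality of order three for the Gaussian measure on the line. -/
theorem gaussianReal_covariance_bound {u g : ℝ → ℝ} (hu : ContDiff ℝ 1 u)
    (hub : ∃ C, ∀ x, |u x| ≤ C) (hu' : ∃ C, ∀ x, |deriv u x| ≤ C) (hg : Continuous g)
    {a b : ℝ} (ha : 0 < a) (hag : ∀ x, a ≤ g x) (hgb : ∀ x, g x ≤ b) :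
    ∫ x, (u x * g x - g x ^ 3 / 3 - deriv u x ^ 2 / (4 * g x)) ∂(gaussianReal 0 1) ≤
      (∫ x, u x ∂(gaussianReal 0 1)) * (∫ x, g x ∂(gaussianReal 0 1)) -
        (∫ x, g x ∂(gaussianReal 0 1)) ^ 3 / 3 := by
  obtain ⟨C₁, hC₁⟩ := hub
  obtain ⟨C₂, hC₂⟩ := hu'
  set γ := gaussianReal 0 1 with hγ
  have bint : ∀ {f : ℝ → ℝ}, Continuous f → (∃ C, ∀ x, |f x| ≤ C) → Integrable f γ := by
    rintro f hf ⟨C, hC⟩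
    exact Integrable.of_bound hf.aestronglyMeasurable C (Eventually.of_forall fun x => hC x)
  have hb : 0 < b := ha.trans_le ((hag 0).trans (hgb 0))
  have hg0 : ∀ x, 0 < g x := fun x => ha.trans_le (hag x)
  have hgabs : ∀ x, |g x| ≤ b := fun x => by rw [abs_of_pos (hg0 x)]; exact hgb x
  have hgi : Integrable g γ := bint hg ⟨b, hgabs⟩
  set m := ∫ x, g x ∂γ with hm
  have hm0 : 0 ≤ m := integral_nonneg fun x => (hg0 x).le
  have hmb : m ≤ b := by
    have := integral_mono hgi (integrable_const b) hgb
    simpa using this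
  have hkB : ∀ x, |g x - m| ≤ b := fun x => abs_le.2
    ⟨by linarith [hg0 x], by linarith [hgb x]⟩
  have hmean : ∫ x, (g x - m) * Real.exp (-x ^ 2 / 2) = 0 := by
    have h0 : ∫ x, (g x - m) ∂γ = 0 := by
      rw [integral_sub hgi (integrable_const m)]; simp [← hm]
    rw [hγ, integral_gaussianReal_eq_integral_smul one_ne_zero] at h0
    have hpdf : ∀ x : ℝ, gaussianPDFReal 0 1 x =
        (Real.sqrt (2 * Real.pi))⁻¹ * Real.exp (-x ^ 2 / 2) := by
      intro x; simp [gaussianPDFReal]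
    simp only [hpdf, smul_eq_mul, mul_assoc] at h0
    rw [integral_const_mul] at h0
    have h1 := (mul_eq_zero.1 h0).resolve_left (by positivity)
    simpa only [mul_comm] using h1
  obtain ⟨ξ, hξ, ⟨C, hC⟩, hlow⟩ := exists_stein_solution (k := fun x => g x - m) (by fun_prop) hkB hmean
  have hξc : Continuous ξ := continuous_iff_continuousAt.2 fun x => (hξ x).continuousAt
  have hC0 : 0 ≤ C := (abs_nonneg _).trans (hC 0).1
  set D : ℝ → ℝ := fun x => x * ξ x - (g x - m) with hD
  have hDc : Continuous D := by fun_prop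
  have hDb : ∀ x, |D x| ≤ C + b := fun x => (abs_sub _ _).trans (add_le_add (hC x).2 (hkB x))

  -- `F` is chosen so that its Gaussian divergence `x F - F'` is `H`. With `k = g - m` and `D = ξ' =
  -- x ξ - k`, the terms regroup into powers of `k` and the two terms `g ξ²`, `D² (g + 2D/3)`.
  set F : ℝ → ℝ := fun x => m * (x * ξ x ^ 2) + (x ^ 2 - 1) * ξ x ^ 3 / 3 with hF
  set H : ℝ → ℝ := fun x => m * (g x - m) ^ 2 + (g x - m) ^ 3 / 3 - g x * ξ x ^ 2
    - D x ^ 2 * (g x + 2 / 3 * D x) with hH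
  have hHb : ∀ x, |H x| ≤ m * b ^ 2 + b ^ 3 / 3 + b * C ^ 2 +
      (C + b) ^ 2 * (b + 2 / 3 * (C + b)) := by
    intro x
    refine (abs_sub _ _).trans (add_le_add ((abs_sub _ _).trans (add_le_add
      ((abs_add_le _ _).trans (add_le_add ?_ ?_)) ?_)) ?_)
    · rw [abs_mul, abs_of_nonneg hm0, abs_pow]
      exact mul_le_mul_of_nonneg_left (pow_le_pow_left₀ (abs_nonneg _) (hkB x) 2) hm0
    · rw [abs_div, abs_of_pos (by norm_num : (0 : ℝ) < 3), abs_pow]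
      exact div_le_div_of_nonneg_right (pow_le_pow_left₀ (abs_nonneg _) (hkB x) 3) (by norm_num)
    · rw [abs_mul, abs_pow]
      exact mul_le_mul (hgabs x) (pow_le_pow_left₀ (abs_nonneg _) (hC x).1 2) (by positivity)
        hb.le
    · rw [abs_mul, abs_pow]
      refine mul_le_mul (pow_le_pow_left₀ (abs_nonneg _) (hDb x) 2) ?_ (abs_nonneg _)
        (by positivity)
      refine (abs_add_le _ _).trans (add_le_add (hgabs x) ?_)
      rw [abs_mul, abs_of_pos (by norm_num : (0 : ℝ) < 2 / 3)]
      exact mul_le_mul_of_nonneg_left (hDb x) (by norm_num)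
  have hH0 : ∫ x, H x ∂γ = 0 := by
    refine integral_gaussian_divergence (F := F)
      (C := (m * (C * C) + (C ^ 2 * C + C ^ 3) / 3) +
        (m * b ^ 2 + b ^ 3 / 3 + b * C ^ 2 + (C + b) ^ 2 * (b + 2 / 3 * (C + b)))) ?_ ?_ ?_
    · intro x
      have h1 := ((hasDerivAt_id x).mul ((hξ x).pow 2)).const_mul m
      have h2 := (((hasDerivAt_pow 2 x).sub_const 1).mul ((hξ x).pow 3)).div_const 3
      refine (h1.add h2).congr_deriv ?_
      simp only [hH, hF, hD, Pi.pow_apply, id_eq]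
      push_cast
      ring
    · intro x
      have e : F x = m * ((x * ξ x) * ξ x) + ((x * ξ x) ^ 2 * ξ x - ξ x ^ 3) / 3 := by
        simp only [hF]; ring
      rw [e]
      have h1 : |(x * ξ x) * ξ x| ≤ C * C := by
        rw [abs_mul]; exact mul_le_mul (hC x).2 (hC x).1 (abs_nonneg _) hC0
      have h2 : |(x * ξ x) ^ 2 * ξ x| ≤ C ^ 2 * C := by
        rw [abs_mul, abs_pow]
        exact mul_le_mul (pow_le_pow_left₀ (abs_nonneg _) (hC x).2 2) (hC x).1 (abs_nonneg _)
          (by positivity)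
      have h3 : |ξ x ^ 3| ≤ C ^ 3 := by
        rw [abs_pow]; exact pow_le_pow_left₀ (abs_nonneg _) (hC x).1 3
      have h4 : 0 ≤ m * b ^ 2 + b ^ 3 / 3 + b * C ^ 2 + (C + b) ^ 2 * (b + 2 / 3 * (C + b)) := by
        positivity
      refine le_trans ((abs_add_le _ _).trans (add_le_add ?_ ?_)) (le_add_of_nonneg_right h4)
      · rw [abs_mul, abs_of_nonneg hm0]; exact mul_le_mul_of_nonneg_left h1 hm0
      · rw [abs_div, abs_of_pos (by norm_num : (0 : ℝ) < 3)]
        exact div_le_div_of_nonneg_right ((abs_sub _ _).trans (add_le_add h2 h3)) (by norm_num)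
    · intro x
      have h4 : 0 ≤ m * (C * C) + (C ^ 2 * C + C ^ 3) / 3 := by positivity
      exact (hHb x).trans (le_add_of_nonneg_left h4)
  have hud : ∀ x, HasDerivAt u (deriv u x) x := fun x =>
    (hu.differentiable (by norm_num)).differentiableAt.hasDerivAt
  have hu'c : Continuous (deriv u) := hu.continuous_deriv (by norm_num)
  set J : ℝ → ℝ := fun x => u x * (g x - m) - deriv u x * ξ x with hJ
  have hC₁0 : 0 ≤ C₁ := (abs_nonneg _).trans (hC₁ 0)
  have hC₂0 : 0 ≤ C₂ := (abs_nonneg _).trans (hC₂ 0)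
  have hJb : ∀ x, |J x| ≤ C₁ * b + C₂ * C := by
    intro x
    refine (abs_sub _ _).trans (add_le_add ?_ ?_) <;> rw [abs_mul]
    · exact mul_le_mul (hC₁ x) (hkB x) (abs_nonneg _) hC₁0
    · exact mul_le_mul (hC₂ x) (hC x).1 (abs_nonneg _) hC₂0
  have hJ0 : ∫ x, J x ∂γ = 0 := by
    refine integral_gaussian_divergence (F := fun x => u x * ξ x)
      (C := C₁ * C + (C₁ * b + C₂ * C)) ?_ ?_ ?_
    · intro x
      refine ((hud x).mul (hξ x)).congr_deriv ?_
      simp only [hJ]; ring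
    · intro x
      rw [abs_mul]
      have := mul_le_mul (hC₁ x) (hC x).1 (abs_nonneg _) hC₁0
      have h2 : 0 ≤ C₁ * b + C₂ * C := by positivity
      linarith
    · intro x
      have := hJb x
      have h2 : 0 ≤ C₁ * C := by positivity
      linarith
  have hui : Integrable u γ := bint hu.continuous ⟨C₁, hC₁⟩
  have hJi : Integrable J γ := bint (by fun_prop) ⟨_, hJb⟩
  have hg3 : Integrable (fun x => g x ^ 3) γ := bint (by fun_prop) ⟨b ^ 3, fun x => by
    rw [abs_pow]; exact pow_le_pow_left₀ (abs_nonneg _) (hgabs x) 3⟩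
  have hHi : Integrable H γ := bint (by fun_prop) ⟨_, hHb⟩
  -- The polynomial terms are arranged so that the integrand equals `u g - g³/3 - u' ξ + g ξ² + D²
  -- (g + 2D/3)` pointwise.
  have hR : ∫ x, (J x - H x + (m * u x - m ^ 2 * g x + 2 / 3 * m ^ 3)) ∂γ =
      (∫ x, u x ∂γ) * m - m ^ 3 / 3 := by
    have h1 : Integrable (fun x => m * u x - m ^ 2 * g x) γ :=
      (hui.const_mul m).sub (hgi.const_mul _)
    have h2 : Integrable (fun x => m * u x - m ^ 2 * g x + 2 / 3 * m ^ 3) γ :=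
      h1.add (integrable_const _)
    have h3 : Integrable (fun x => J x - H x) γ := hJi.sub hHi
    rw [integral_add h3 h2, integral_sub hJi hHi, hJ0, hH0, integral_add h1 (integrable_const _),
      integral_sub (hui.const_mul m) (hgi.const_mul _), integral_const_mul, integral_const_mul,
      ← hm]
    simp
    ring
  rw [← hR]
  refine integral_mono ?_ ((hJi.sub hHi).add (((hui.const_mul m).sub (hgi.const_mul _)).add
      (integrable_const _))) fun x => ?_
  · refine ((bint (f := fun x => u x * g x) (hu.continuous.mul hg) ⟨C₁ * b, fun x => ?_⟩).sub (hg3.div_const 3)).sub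
      (bint (f := fun x => deriv u x ^ 2 / (4 * g x)) ?_ ⟨C₂ ^ 2 / (4 * a), fun x => ?_⟩)
    · rw [abs_mul]; exact mul_le_mul (hC₁ x) (hgabs x) (abs_nonneg _) hC₁0
    · exact (hu'c.pow 2).div (by fun_prop) fun x => by have := hg0 x; positivity
    · have := hg0 x
      rw [abs_div, abs_pow, abs_of_pos (by positivity : 0 < 4 * g x)]
      exact div_le_div₀ (by positivity) (pow_le_pow_left₀ (abs_nonneg _) (hC₂ x) 2)
        (by positivity) (by linarith [hag x])
  · simp only [hJ, hH]
    have hgx := hg0 x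
    -- As `g - m ≥ -m`, the lower bound on `x ξ` applies; it gives `g + 2D/3 = g/3 + 2(m + x ξ)/3 ≥
    -- 0`.
    have hA : -m ≤ x * ξ x := hlow m hm0 (fun t => by simpa using (hg0 t).le) x
    have hpos : 0 ≤ D x ^ 2 * (g x + 2 / 3 * D x) := by
      refine mul_nonneg (sq_nonneg _) ?_
      have e : g x = (m + x * ξ x) - D x := by simp only [hD]; ring
      linarith
    have hsq : deriv u x * ξ x ≤ deriv u x ^ 2 / (4 * g x) + g x * ξ x ^ 2 := by
      have e : deriv u x ^ 2 / (4 * g x) + g x * ξ x ^ 2 - deriv u x * ξ x =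
        (deriv u x - 2 * g x * ξ x) ^ 2 / (4 * g x) := by
        field_simp; ring
      have : 0 ≤ (deriv u x - 2 * g x * ξ x) ^ 2 / (4 * g x) := by positivity
      linarith
    nlinarith [hpos, hsq]

/-! ### The dual inequality on `ℝⁿ` and its stability properties. -/

/-- Shorthand for the Euclidean space `ℝⁿ`. -/
abbrev Euc (n : ℕ) : Type := EuclideanSpace ℝ (Fin n)

/-- The partial derivative `∂ᵢ f`. -/
noncomputable def partialDeriv {n : ℕ} (f : Euc n → ℝ) (i : Fin n) (x : Euc n) : ℝ :=
  fderiv ℝ f x (EuclideanSpace.single i 1)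

theorem sum_apply_single_sq {n : ℕ} (L : Euc n →L[ℝ] ℝ) :
    ∑ i, L (EuclideanSpace.single i 1) ^ 2 = ‖L‖ ^ 2 := by
  obtain ⟨v, rfl⟩ := (InnerProductSpace.toDual ℝ (Euc n)).surjective L
  rw [LinearIsometryEquiv.norm_map, EuclideanSpace.norm_sq_eq]
  refine Finset.sum_congr rfl fun i _ => ?_
  rw [InnerProductSpace.toDual_apply_apply, EuclideanSpace.inner_single_right]
  simp

theorem sum_partialDeriv_sq {n : ℕ} (f : Euc n → ℝ) (x : Euc n) :
    ∑ i, partialDeriv f i x ^ 2 = ‖fderiv ℝ f x‖ ^ 2 :=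
  sum_apply_single_sq _

/-- The pairs of functions to which the dual inequality is applied. -/
structure IsTestPair {n : ℕ} (f g : Euc n → ℝ) : Prop where
  contDiff : ContDiff ℝ 1 f
  bdd : ∃ C, ∀ x, |f x| ≤ C
  fderiv_bdd : ∃ C, ∀ x, ‖fderiv ℝ f x‖ ≤ C
  cont : Continuous g
  lower : ∃ a, 0 < a ∧ ∀ x, a ≤ g x
  upper : ∃ b, ∀ x, g x ≤ b

/-- The integrand on the left-hand side of the dual inequality. -/
noncomputable def dualIntegrand {n : ℕ} (c : Fin n → ℝ) (f g : Euc n → ℝ) (x : Euc n) : ℝ :=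
  f x * g x - g x ^ 3 / 3 - (∑ i, c i * partialDeriv f i x ^ 2) / (4 * g x)

/-- The dual inequality, with weights `c`, for the measure `ν`. -/
def DualInequality {n : ℕ} (ν : Measure (Euc n)) (c : Fin n → ℝ) : Prop :=
  ∀ f g, IsTestPair f g →
    ∫ x, dualIntegrand c f g x ∂ν ≤ (∫ x, f x ∂ν) * (∫ x, g x ∂ν) - (∫ x, g x ∂ν) ^ 3 / 3

namespace IsTestPair

variable {n : ℕ} {f g : Euc n → ℝ}

theorem pos (h : IsTestPair f g) (x : Euc n) : 0 < g x := by
  obtain ⟨a, ha, hag⟩ := h.lower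
  exact ha.trans_le (hag x)

theorem abs_bdd (h : IsTestPair f g) : ∃ C, ∀ x, |g x| ≤ C := by
  obtain ⟨b, hb⟩ := h.upper
  exact ⟨b, fun x => by rw [abs_of_pos (h.pos x)]; exact hb x⟩

theorem continuous_fderiv (h : IsTestPair f g) : Continuous (fderiv ℝ f) :=
  h.contDiff.continuous_fderiv (by norm_num)

theorem continuous_partialDeriv (h : IsTestPair f g) (i : Fin n) :
    Continuous (partialDeriv f i) :=
  h.continuous_fderiv.clm_apply continuous_const

theorem partialDeriv_bdd (h : IsTestPair f g) : ∃ C, ∀ i x, |partialDeriv f i x| ≤ C := by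
  obtain ⟨C, hC⟩ := h.fderiv_bdd
  refine ⟨C, fun i x => ?_⟩
  have := (fderiv ℝ f x).le_opNorm (EuclideanSpace.single i (1 : ℝ))
  simp only [PiLp.norm_single, norm_one, mul_one] at this
  exact this.trans (hC x)

theorem continuous_sq_div (h : IsTestPair f g) (i : Fin n) :
    Continuous fun x => partialDeriv f i x ^ 2 / g x :=
  ((h.continuous_partialDeriv i).pow 2).div h.cont fun x => (h.pos x).ne'

theorem sq_div_bdd (h : IsTestPair f g) (i : Fin n) :
    ∃ C, ∀ x, |partialDeriv f i x ^ 2 / g x| ≤ C := by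
  obtain ⟨C, hC⟩ := h.partialDeriv_bdd
  obtain ⟨a, ha, hag⟩ := h.lower
  refine ⟨C ^ 2 / a, fun x => ?_⟩
  rw [abs_div, abs_pow, abs_of_pos (h.pos x)]
  exact div_le_div₀ (sq_nonneg _) (pow_le_pow_left₀ (abs_nonneg _) (hC i x) 2) ha (hag x)

theorem dualIntegrand_eq (c : Fin n → ℝ) (x : Euc n) : dualIntegrand c f g x =
    f x * g x - g x ^ 3 / 3 - ∑ i, c i / 4 * (partialDeriv f i x ^ 2 / g x) := by
  rw [dualIntegrand, Finset.sum_div]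
  congr 1
  refine Finset.sum_congr rfl fun i _ => ?_
  rw [div_mul_div_comm]

theorem continuous_dualIntegrand (h : IsTestPair f g) (c : Fin n → ℝ) :
    Continuous (dualIntegrand c f g) := by
  rw [funext (dualIntegrand_eq (f := f) (g := g) c)]
  have h1 := h.contDiff.continuous
  have h2 := h.cont
  have h3 := h.continuous_sq_div
  fun_prop

theorem dualIntegrand_bdd (h : IsTestPair f g) (c : Fin n → ℝ) :
    ∃ C, ∀ x, |dualIntegrand c f g x| ≤ C := by
  obtain ⟨Cf, hf⟩ := h.bdd
  obtain ⟨Cg, hg⟩ := h.abs_bdd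
  choose K hK using h.sq_div_bdd
  refine ⟨Cf * Cg + Cg ^ 3 / 3 + ∑ i, |c i / 4| * K i, fun x => ?_⟩
  rw [dualIntegrand_eq]
  refine (abs_sub _ _).trans (add_le_add ((abs_sub _ _).trans (add_le_add ?_ ?_)) ?_)
  · rw [abs_mul]
    exact mul_le_mul (hf x) (hg x) (abs_nonneg _) ((abs_nonneg _).trans (hf x))
  · rw [abs_div, abs_pow, abs_of_pos (by norm_num : (0 : ℝ) < 3)]
    exact div_le_div_of_nonneg_right (pow_le_pow_left₀ (abs_nonneg _) (hg x) 3) (by norm_num)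
  · refine (Finset.abs_sum_le_sum_abs _ _).trans (Finset.sum_le_sum fun i _ => ?_)
    rw [abs_mul]
    exact mul_le_mul_of_nonneg_left (hK i x) (abs_nonneg _)

end IsTestPair

theorem integrable_of_continuous_bdd {X : Type*} [TopologicalSpace X] [MeasurableSpace X]
    [OpensMeasurableSpace X] {ν : Measure X} [IsFiniteMeasure ν] {f : X → ℝ}
    (hf : Continuous f) (hb : ∃ C, ∀ x, |f x| ≤ C) : Integrable f ν := by
  obtain ⟨C, hC⟩ := hb
  exact Integrable.of_bound hf.measurable.aestronglyMeasurable C (Eventually.of_forall hC)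

theorem continuous_average {n : ℕ} (ν : Measure (Euc n)) [IsFiniteMeasure ν] {φ : Euc n → ℝ}
    (hφ : Continuous φ) (hb : ∃ C, ∀ x, |φ x| ≤ C) : Continuous fun x => ∫ y, φ (x + y) ∂ν := by
  obtain ⟨C, hC⟩ := hb
  exact continuous_of_dominated (bound := fun _ => C)
    (fun x => (hφ.comp (by fun_prop : Continuous fun y => x + y)).aestronglyMeasurable)
    (fun x => Eventually.of_forall fun y => hC _) (integrable_const _)
    (Eventually.of_forall fun y => hφ.comp (by fun_prop))

theorem average_bdd {n : ℕ} (ν : Measure (Euc n)) [IsProbabilityMeasure ν] {φ : Euc n → ℝ}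
    {C : ℝ} (hC : ∀ x, |φ x| ≤ C) (x : Euc n) : |∫ y, φ (x + y) ∂ν| ≤ C := by
  have := norm_integral_le_of_norm_le_const (μ := ν) (f := fun y => φ (x + y))
    (Eventually.of_forall fun y => hC (x + y))
  simpa using this

/-- Cauchy-Schwarz inequality, as convexity of `(p, g) ↦ p² / g`. -/
theorem sq_integral_div_le {X : Type*} [MeasurableSpace X] {ν : Measure X} {p g : X → ℝ}
    (hp : Integrable p ν) (hg : Integrable g ν) (hpg : Integrable (fun x => p x ^ 2 / g x) ν)
    (hg0 : ∀ x, 0 < g x) : (∫ x, p x ∂ν) ^ 2 / (∫ x, g x ∂ν) ≤ ∫ x, p x ^ 2 / g x ∂ν := by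
  set P := ∫ x, p x ∂ν with hP
  set G := ∫ x, g x ∂ν with hG
  have hG0 : 0 ≤ G := integral_nonneg fun x => (hg0 x).le
  rcases hG0.eq_or_lt with h0 | hpos
  · rw [← h0, div_zero]
    exact integral_nonneg fun x => div_nonneg (sq_nonneg _) (hg0 x).le
  have key : ∫ x, (2 * (P / G) * p x - (P / G) ^ 2 * g x) ∂ν ≤ ∫ x, p x ^ 2 / g x ∂ν := by
    refine integral_mono ((hp.const_mul _).sub (hg.const_mul _)) hpg fun x => ?_
    have hx := hg0 x
    have e : p x ^ 2 / g x - (2 * (P / G) * p x - (P / G) ^ 2 * g x) =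
        (p x - P / G * g x) ^ 2 / g x := by
      field_simp
      ring
    have : 0 ≤ (p x - P / G * g x) ^ 2 / g x := by positivity
    show 2 * (P / G) * p x - (P / G) ^ 2 * g x ≤ p x ^ 2 / g x
    linarith
  rw [integral_sub (hp.const_mul _) (hg.const_mul _), integral_const_mul, integral_const_mul,
    ← hP, ← hG] at key
  refine le_trans (le_of_eq ?_) key
  field_simp
  ring

section Averages

variable {n : ℕ} {f g : Euc n → ℝ} (ν : Measure (Euc n)) [IsProbabilityMeasure ν]

theorem IsTestPair.translate (h : IsTestPair f g) (x : Euc n) :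
    IsTestPair (fun y => f (x + y)) (fun y => g (x + y)) where
  contDiff := h.contDiff.comp (contDiff_const.add contDiff_id)
  bdd := let ⟨C, hC⟩ := h.bdd; ⟨C, fun y => hC _⟩
  fderiv_bdd := by
    obtain ⟨C, hC⟩ := h.fderiv_bdd
    refine ⟨C, fun y => ?_⟩
    rw [fderiv_comp_add_left]
    exact hC _
  cont := h.cont.comp (by fun_prop)
  lower := let ⟨a, ha, hag⟩ := h.lower; ⟨a, ha, fun y => hag _⟩
  upper := let ⟨b, hb⟩ := h.upper; ⟨b, fun y => hb _⟩

theorem IsTestPair.hasFDerivAt_average (h : IsTestPair f g) (x : Euc n) :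
    HasFDerivAt (fun x => ∫ y, f (x + y) ∂ν) (∫ y, fderiv ℝ f (x + y) ∂ν) x := by
  obtain ⟨C, hC⟩ := h.fderiv_bdd
  have hfc := h.contDiff.continuous
  have hdc := h.continuous_fderiv
  refine hasFDerivAt_integral_of_dominated_of_fderiv_le (𝕜 := ℝ) (μ := ν)
    (F := fun x y => f (x + y)) (F' := fun x y => fderiv ℝ f (x + y)) (s := univ) (bound := fun _ => C) univ_mem
    (Eventually.of_forall fun x => ?_) ?_ ?_ ?_ (integrable_const _) ?_
  · exact (hfc.comp (by fun_prop : Continuous fun y => x + y)).aestronglyMeasurable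
  · exact integrable_of_continuous_bdd (h.translate x).contDiff.continuous (h.translate x).bdd
  · exact (hdc.comp (by fun_prop : Continuous fun y => x + y)).aestronglyMeasurable
  · exact Eventually.of_forall fun y x _ => hC _
  · refine Eventually.of_forall fun y x _ => ?_
    have := ((h.contDiff.differentiable (by norm_num)) (x + y)).hasFDerivAt
    exact (hasFDerivAt_comp_add_right y).2 this

theorem IsTestPair.average (h : IsTestPair f g) :
    IsTestPair (fun x => ∫ y, f (x + y) ∂ν) (fun x => ∫ y, g (x + y) ∂ν) := by
  have hgi : ∀ x, Integrable (fun y => g (x + y)) ν := fun x =>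
    integrable_of_continuous_bdd (h.translate x).cont (h.translate x).abs_bdd
  constructor
  · rw [contDiff_one_iff_fderiv]
    refine ⟨fun x => (h.hasFDerivAt_average ν x).differentiableAt, ?_⟩
    rw [funext fun x => (h.hasFDerivAt_average ν x).fderiv]
    obtain ⟨C, hC⟩ := h.fderiv_bdd
    have hdc := h.continuous_fderiv
    refine continuous_of_dominated (bound := fun _ => C) (fun x => ?_)
      (fun x => Eventually.of_forall fun y => hC _) (integrable_const _)
      (Eventually.of_forall fun y => ?_)
    · exact (hdc.comp (by fun_prop : Continuous fun y => x + y)).aestronglyMeasurable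
    · exact hdc.comp (by fun_prop : Continuous fun x => x + y)
  · exact h.bdd.imp fun C hC => average_bdd ν hC
  · obtain ⟨C, hC⟩ := h.fderiv_bdd
    refine ⟨C, fun x => ?_⟩
    rw [(h.hasFDerivAt_average ν x).fderiv]
    have := norm_integral_le_of_norm_le_const (μ := ν) (f := fun y => fderiv ℝ f (x + y))
      (Eventually.of_forall fun y => hC (x + y))
    simpa using this
  · exact continuous_average ν h.cont h.abs_bdd
  · obtain ⟨a, ha, hag⟩ := h.lower
    refine ⟨a, ha, fun x => ?_⟩
    have := integral_mono (integrable_const a) (hgi x) fun y => hag (x + y)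
    simpa using this
  · obtain ⟨b, hb⟩ := h.upper
    refine ⟨b, fun x => ?_⟩
    have := integral_mono (hgi x) (integrable_const b) fun y => hb (x + y)
    simpa using this

theorem IsTestPair.partialDeriv_average (h : IsTestPair f g) (i : Fin n) (x : Euc n) :
    partialDeriv (fun x => ∫ y, f (x + y) ∂ν) i x = ∫ y, partialDeriv f i (x + y) ∂ν := by
  obtain ⟨C, hC⟩ := h.fderiv_bdd
  rw [partialDeriv, (h.hasFDerivAt_average ν x).fderiv, ContinuousLinearMap.integral_apply]
  · rfl
  · exact Integrable.of_bound (h.continuous_fderiv.comp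
      (by fun_prop : Continuous fun y => x + y)).aestronglyMeasurable C
      (Eventually.of_forall fun y => hC _)

theorem partialDeriv_translate (f : Euc n → ℝ) (i : Fin n) (x y : Euc n) :
    partialDeriv (fun y => f (x + y)) i y = partialDeriv f i (x + y) := by
  rw [partialDeriv, partialDeriv, fderiv_comp_add_left]

end Averages

/-- Apply the inequality of `ν₂` to the translates of `f` and `g`, then that of `ν₁` to their
averages. The gradient terms with weights `c₁` only shrink under averaging, by joint convexity of
`p²/g`. Separate weights for each coordinate let one-dimensional measures on the axes be combined.
-/
theorem DualInequality.conv {n : ℕ} {ν₁ ν₂ : Measure (Euc n)} [IsProbabilityMeasure ν₁]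
    [IsProbabilityMeasure ν₂] {c₁ c₂ : Fin n → ℝ} (h₁ : DualInequality ν₁ c₁)
    (h₂ : DualInequality ν₂ c₂) (hc₁ : ∀ i, 0 ≤ c₁ i) :
    DualInequality (ν₁.conv ν₂) (c₁ + c₂) := by
  intro f g h
  have hint : ∀ {φ : Euc n → ℝ}, Continuous φ → (∃ C, ∀ x, |φ x| ≤ C) →
      ∫ z, φ z ∂(ν₁.conv ν₂) = ∫ x, ∫ y, φ (x + y) ∂ν₂ ∂ν₁ := fun hφ hb =>
    integral_conv (integrable_of_continuous_bdd hφ hb)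
  rw [hint h.contDiff.continuous h.bdd, hint h.cont h.abs_bdd,
    hint (h.continuous_dualIntegrand _) (h.dualIntegrand_bdd _)]
  have hav := h.average ν₂
  refine le_trans (integral_mono
    (integrable_of_continuous_bdd (continuous_average ν₂ (h.continuous_dualIntegrand _)
      (h.dualIntegrand_bdd _)) ((h.dualIntegrand_bdd _).imp fun C hC => average_bdd ν₂ hC))
    (integrable_of_continuous_bdd (hav.continuous_dualIntegrand _) (hav.dualIntegrand_bdd c₁))
    fun x => ?_) (h₁ _ _ hav)
  have hx := h.translate x
  have hsplit : ∀ y, dualIntegrand (c₁ + c₂) f g (x + y) =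
      dualIntegrand c₂ (fun y => f (x + y)) (fun y => g (x + y)) y -
        ∑ i, c₁ i / 4 * (partialDeriv f i (x + y) ^ 2 / g (x + y)) := by
    intro y
    simp only [IsTestPair.dualIntegrand_eq, partialDeriv_translate, Pi.add_apply, add_div, add_mul,
      Finset.sum_add_distrib]
    ring
  have hsq : ∀ i, Integrable (fun y => partialDeriv f i (x + y) ^ 2 / g (x + y)) ν₂ := fun i =>
    integrable_of_continuous_bdd ((h.continuous_sq_div i).comp (by fun_prop))
      ((h.sq_div_bdd i).imp fun C hC y => hC _)
  have hpi : ∀ i, Integrable (fun y => partialDeriv f i (x + y)) ν₂ := fun i =>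
    integrable_of_continuous_bdd ((h.continuous_partialDeriv i).comp (by fun_prop))
      (h.partialDeriv_bdd.imp fun C hC y => hC i _)
  have hgi := integrable_of_continuous_bdd (ν := ν₂) hx.cont hx.abs_bdd
  simp only [hsplit]
  rw [integral_sub (integrable_of_continuous_bdd (hx.continuous_dualIntegrand _)
    (hx.dualIntegrand_bdd _)) (integrable_finsetSum _ fun i _ => (hsq i).const_mul _),
    integral_finsetSum _ fun i _ => (hsq i).const_mul _, IsTestPair.dualIntegrand_eq]
  refine sub_le_sub (h₂ _ _ hx) (Finset.sum_le_sum fun i _ => ?_)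
  rw [integral_const_mul, h.partialDeriv_average ν₂]
  exact mul_le_mul_of_nonneg_left (sq_integral_div_le (hpi i) hgi (hsq i) fun y => h.pos _)
    (div_nonneg (hc₁ i) (by norm_num))

/-- Without the gradient term both sides agree. Dirac masses start the two inductions, over the axes
and over the Langevin steps. -/
theorem dualInequality_dirac {n : ℕ} (x : Euc n) {c : Fin n → ℝ} (hc : ∀ i, 0 ≤ c i) :
    DualInequality (Measure.dirac x) c := by
  intro f g h
  simp only [integral_dirac, dualIntegrand]
  have := h.pos x
  have : 0 ≤ (∑ i, c i * partialDeriv f i x ^ 2) / (4 * g x) :=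
    div_nonneg (Finset.sum_nonneg fun i _ => mul_nonneg (hc i) (sq_nonneg _)) (by positivity)
  linarith

theorem DualInequality.mono {n : ℕ} {ν : Measure (Euc n)} [IsFiniteMeasure ν]
    {c c' : Fin n → ℝ} (hν : DualInequality ν c) (hc : ∀ i, c i ≤ c' i) : DualInequality ν c' := by
  intro f g h
  refine le_trans (integral_mono
    (integrable_of_continuous_bdd (h.continuous_dualIntegrand _) (h.dualIntegrand_bdd _))
    (integrable_of_continuous_bdd (h.continuous_dualIntegrand _) (h.dualIntegrand_bdd _))
    fun x => ?_) (hν f g h)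
  have := h.pos x
  refine sub_le_sub_left (div_le_div_of_nonneg_right ?_ (by positivity)) _
  exact Finset.sum_le_sum fun i _ => mul_le_mul_of_nonneg_right (hc i) (sq_nonneg _)

theorem IsTestPair.comp {n : ℕ} {f g : Euc n → ℝ} (h : IsTestPair f g) {T : Euc n → Euc n}
    (hT : ContDiff ℝ 1 T) {θ : NNReal} (hθ : LipschitzWith θ T) :
    IsTestPair (fun x => f (T x)) (fun x => g (T x)) ∧
      ∀ x, ‖fderiv ℝ (fun x => f (T x)) x‖ ≤ θ * ‖fderiv ℝ f (T x)‖ := by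
  have key : ∀ x, ‖fderiv ℝ (fun x => f (T x)) x‖ ≤ θ * ‖fderiv ℝ f (T x)‖ := by
    intro x
    have e : fderiv ℝ (fun x => f (T x)) x = (fderiv ℝ f (T x)).comp (fderiv ℝ T x) :=
      fderiv_comp x (h.contDiff.differentiable (by norm_num) _)
        (hT.differentiable (by norm_num) _)
    rw [e, mul_comm]
    exact (ContinuousLinearMap.opNorm_comp_le _ _).trans
      (mul_le_mul_of_nonneg_left (norm_fderiv_le_of_lipschitz ℝ hθ) (norm_nonneg _))
  refine ⟨⟨h.contDiff.comp hT, h.bdd.imp fun C hC x => hC _, ?_, h.cont.comp hT.continuous,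
    h.lower.imp fun a ha => ⟨ha.1, fun x => ha.2 _⟩, h.upper.imp fun C hC x => hC _⟩, key⟩
  obtain ⟨C, hC⟩ := h.fderiv_bdd
  exact ⟨θ * C, fun x => (key x).trans (mul_le_mul_of_nonneg_left (hC _) θ.2)⟩

/-- The chain rule bounds `|∇(f ∘ T)|` by `θ |∇f| ∘ T`. Equal weights are needed because only the
full norm of the gradient is controlled. -/
theorem DualInequality.map {n : ℕ} {ν : Measure (Euc n)} [IsFiniteMeasure ν] {c : ℝ}
    (hc : 0 ≤ c) (hν : DualInequality ν fun _ => c) {T : Euc n → Euc n} (hT : ContDiff ℝ 1 T)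
    {θ : NNReal} (hθ : LipschitzWith θ T) : DualInequality (ν.map T) fun _ => θ ^ 2 * c := by
  intro f g h
  have hTm : AEMeasurable T ν := hT.continuous.measurable.aemeasurable
  obtain ⟨hfg, hd⟩ := h.comp hT hθ
  rw [integral_map hTm h.contDiff.continuous.aestronglyMeasurable,
    integral_map hTm h.cont.aestronglyMeasurable,
    integral_map hTm (h.continuous_dualIntegrand _).aestronglyMeasurable]
  refine le_trans (integral_mono
    (integrable_of_continuous_bdd ((h.continuous_dualIntegrand _).comp hT.continuous)
      ((h.dualIntegrand_bdd _).imp fun C hC x => hC _))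
    (integrable_of_continuous_bdd (hfg.continuous_dualIntegrand _) (hfg.dualIntegrand_bdd _))
    fun x => ?_) (hν _ _ hfg)
  have := h.pos (T x)
  refine sub_le_sub_left (div_le_div_of_nonneg_right ?_ (by positivity)) _
  rw [← Finset.mul_sum, ← Finset.mul_sum, sum_partialDeriv_sq, sum_partialDeriv_sq,
    mul_comm _ c, mul_assoc, ← mul_pow]
  exact mul_le_mul_of_nonneg_left (pow_le_pow_left₀ (norm_nonneg _) (hd x) 2) hc

theorem DualInequality.of_tendsto {n : ℕ} {ι : Type*} {l : Filter ι} [l.NeBot]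
    {νs : ι → Measure (Euc n)} {ν : Measure (Euc n)} {c : Fin n → ℝ}
    (hνs : ∀ i, DualInequality (νs i) c)
    (hlim : ∀ φ : Euc n → ℝ, Continuous φ → (∃ C, ∀ x, |φ x| ≤ C) →
      Tendsto (fun i => ∫ x, φ x ∂(νs i)) l (𝓝 (∫ x, φ x ∂ν))) : DualInequality ν c := by
  intro f g h
  have hf := hlim f h.contDiff.continuous h.bdd
  have hg := hlim g h.cont h.abs_bdd
  exact le_of_tendsto_of_tendsto' (hlim _ (h.continuous_dualIntegrand _) (h.dualIntegrand_bdd _))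
    ((hf.mul hg).sub ((hg.pow 3).div_const 3)) fun i => hνs i f g h

/-! ### From the line to the standard Gaussian measure. -/

theorem dualInequality_gaussianReal_single {n : ℕ} (i : Fin n) :
    DualInequality ((gaussianReal 0 1).map fun t => t • (EuclideanSpace.single i 1 : Euc n))
      (Pi.single i 1) := by
  intro f g h
  have hTc : Continuous fun t : ℝ => t • (EuclideanSpace.single i 1 : Euc n) := by fun_prop
  have hTm : AEMeasurable (fun t : ℝ => t • (EuclideanSpace.single i 1 : Euc n))
    (gaussianReal 0 1) := hTc.measurable.aemeasurable
  rw [integral_map hTm h.contDiff.continuous.aestronglyMeasurable,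
    integral_map hTm h.cont.aestronglyMeasurable,
    integral_map hTm (h.continuous_dualIntegrand _).aestronglyMeasurable]
  have hd : ∀ t : ℝ, deriv (fun t : ℝ => f (t • (EuclideanSpace.single i 1 : Euc n))) t =
      partialDeriv f i (t • EuclideanSpace.single i 1) := by
    intro t
    have h1 : HasDerivAt (fun t : ℝ => t • (EuclideanSpace.single i 1 : Euc n))
        (EuclideanSpace.single i 1) t := by
      simpa using (hasDerivAt_id t).smul_const (EuclideanSpace.single i 1 : Euc n)
    exact (((h.contDiff.differentiable (by norm_num)) _).hasFDerivAt.comp_hasDerivAt t h1).deriv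
  obtain ⟨a, ha, hag⟩ := h.lower
  obtain ⟨b, hgb⟩ := h.upper
  refine le_trans (le_of_eq (integral_congr_ae (Eventually.of_forall fun t => ?_)))
    (gaussianReal_covariance_bound
    (u := fun t : ℝ => f (t • (EuclideanSpace.single i 1 : Euc n)))
    (g := fun t : ℝ => g (t • (EuclideanSpace.single i 1 : Euc n)))
    (h.contDiff.comp (contDiff_id.smul contDiff_const)) (h.bdd.imp fun C hC t => hC _)
    (h.partialDeriv_bdd.imp fun C hC t => by rw [hd]; exact hC i _) (h.cont.comp hTc) ha
    (fun t => hag _) (fun t => hgb _))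
  simp only [dualIntegrand, hd]
  congr 2
  rw [Finset.sum_eq_single i]
  · simp
  · intro j _ hj; simp [hj]
  · simp

theorem dualInequality_stdGaussian (n : ℕ) : DualInequality (stdGaussian (Euc n)) fun _ => 1 := by
  -- The convolution of the Gaussians on the axes in `s` is tracked through its characteristic
  -- function, which identifies the final measure.
  have key : ∀ s : Finset (Fin n), ∃ ν : Measure (Euc n), IsProbabilityMeasure ν ∧
      DualInequality ν (fun i => if i ∈ s then 1 else 0) ∧
      ∀ t, charFun ν t = ∏ i ∈ s, Complex.exp (-((t i : ℝ) : ℂ) ^ 2 / 2) := by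
    intro s
    induction s using Finset.induction_on with
    | empty =>
      refine ⟨Measure.dirac 0, inferInstance, dualInequality_dirac 0 (by simp), fun t => ?_⟩
      simp [charFun_dirac]
    | insert i s hi ih =>
      obtain ⟨ν, hν, hD, hchar⟩ := ih
      set ρ := (gaussianReal 0 1).map fun t => t • (EuclideanSpace.single i 1 : Euc n) with hρ
      have hTc : Continuous fun t : ℝ => t • (EuclideanSpace.single i 1 : Euc n) := by fun_prop
      have : IsProbabilityMeasure ρ := Measure.isProbabilityMeasure_map hTc.measurable.aemeasurable
      refine ⟨ρ.conv ν, inferInstance, ?_, fun t => ?_⟩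
      · refine ((dualInequality_gaussianReal_single i).conv hD fun j => ?_).mono fun j => ?_
        · by_cases hj : j = i
          · subst hj; simp
          · simp [hj]
        · by_cases hj : j = i
          · subst hj; simp [hi]
          · simp [hj]
      · rw [charFun_conv, hchar, Finset.prod_insert hi]
        congr 1
        have h1 := charFun_gaussianReal (μ := 0) (v := 1) (t i)
        rw [charFun_apply, hρ, integral_map hTc.measurable.aemeasurable (by fun_prop)]
        rw [charFun_apply] at h1
        simp only [inner_smul_left, EuclideanSpace.inner_single_left, map_one, one_mul]
        convert h1 using 2
        · funext x
          simp [mul_comm]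
        · simp [neg_div]
  obtain ⟨ν, hν, hD, hchar⟩ := key Finset.univ
  have : ν = stdGaussian (Euc n) := by
    refine Measure.ext_of_charFun (funext fun t => ?_)
    rw [hchar, charFun_stdGaussian, ← Complex.exp_sum]
    congr 1
    rw [← Finset.sum_div, Finset.sum_neg_distrib, ← Complex.ofReal_pow,
      EuclideanSpace.norm_sq_eq]
    simp
  rw [← this]
  simpa using hD

/-! ### Gaussian noise of variance `h`. -/

section Noise

variable {n : ℕ}

theorem integrable_exp_neg_mul_sq_norm {b : ℝ} (hb : 0 < b) :
    Integrable fun x : Euc n => Real.exp (-b * ‖x‖ ^ 2) := by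
  refine (GaussianFourier.integrable_cexp_neg_mul_sq_norm_add (b := (b : ℂ)) (by simpa using hb) 0
    (0 : Euc n)).norm.congr (Eventually.of_forall fun x => ?_)
  have : (-(b : ℂ) * (‖x‖ : ℂ) ^ 2).re = -b * ‖x‖ ^ 2 := by
    rw [← Complex.ofReal_neg, ← Complex.ofReal_pow, ← Complex.ofReal_mul, Complex.ofReal_re]
  simp only [zero_mul, add_zero, Complex.norm_exp, this]

/-- The density of the centred Gaussian measure with covariance `h • Id`. -/
noncomputable def noiseDensity (n : ℕ) (h : ℝ) (x : Euc n) : ℝ :=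
  (Real.sqrt h ^ n)⁻¹ * (1 / Real.sqrt ((2 * Real.pi) ^ n)) * Real.exp (-‖x‖ ^ 2 / (2 * h))

/-- The centred Gaussian measure with covariance `h • Id`. -/
noncomputable def noise (n : ℕ) (h : ℝ) : Measure (Euc n) :=
  (stdGaussian (Euc n)).map fun z => Real.sqrt h • z

instance (h : ℝ) : IsProbabilityMeasure (noise n h) :=
  Measure.isProbabilityMeasure_map (by fun_prop)

theorem integral_noise {h : ℝ} {ψ : Euc n → ℝ} (hψ : Continuous ψ) :
    ∫ x, ψ x ∂(noise n h) = ∫ z, ψ (Real.sqrt h • z) ∂(stdGaussian (Euc n)) :=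
  integral_map (by fun_prop) hψ.aestronglyMeasurable

theorem integral_stdGaussian_comp_smul {h : ℝ} (hh : 0 < h) (ψ : Euc n → ℝ) :
    ∫ z, ψ (Real.sqrt h • z) ∂(stdGaussian (Euc n)) = ∫ x, ψ x * noiseDensity n h x := by
  have hs : 0 < Real.sqrt h := Real.sqrt_pos.2 hh
  rw [← gaussianMeasure_eq_stdGaussian, gaussianMeasure,
    integral_withDensity_eq_integral_toReal_smul (by fun_prop)
      (Eventually.of_forall fun _ => ENNReal.ofReal_lt_top)]
  have key := Measure.integral_comp_smul volume
    (fun x : Euc n => ψ x * noiseDensity n h x) (Real.sqrt h)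
  rw [finrank_euclideanSpace_fin, abs_of_pos (by positivity), smul_eq_mul] at key
  rw [eq_inv_mul_iff_mul_eq₀ (by positivity)] at key
  rw [← key, ← integral_const_mul]
  refine integral_congr_ae (Eventually.of_forall fun z => ?_)
  have e : -‖Real.sqrt h • z‖ ^ 2 / (2 * h) = -‖z‖ ^ 2 / 2 := by
    rw [norm_smul, mul_pow, Real.norm_eq_abs, sq_abs, Real.sq_sqrt hh.le]
    field_simp
  simp only [noiseDensity, e, smul_eq_mul]
  rw [ENNReal.toReal_ofReal (by positivity)]
  field_simp

theorem integral_mul_noiseDensity_sub {h : ℝ} (hh : 0 < h) (ψ : Euc n → ℝ) (c : Euc n) :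
    ∫ x, ψ x * noiseDensity n h (x - c) =
      ∫ z, ψ (c + Real.sqrt h • z) ∂(stdGaussian (Euc n)) := by
  rw [integral_stdGaussian_comp_smul hh fun x => ψ (c + x)]
  rw [← integral_add_left_eq_self _ c]
  simp

theorem integral_noiseDensity_sub {h : ℝ} (hh : 0 < h) (c : Euc n) :
    ∫ x, noiseDensity n h (x - c) = 1 := by
  have := integral_mul_noiseDensity_sub hh (fun _ => 1) c
  simpa using this

theorem continuous_noiseDensity (h : ℝ) : Continuous (noiseDensity n h) := by
  unfold noiseDensity
  fun_prop

theorem noiseDensity_sub_comm (h : ℝ) (x y : Euc n) :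
    noiseDensity n h (x - y) = noiseDensity n h (y - x) := by
  rw [noiseDensity, noiseDensity, norm_sub_rev]

theorem integrable_noiseDensity {h : ℝ} (hh : 0 < h) : Integrable (noiseDensity n h) := by
  refine ((integrable_exp_neg_mul_sq_norm (b := 1 / (2 * h)) (by positivity)).const_mul
    ((Real.sqrt h ^ n)⁻¹ * (1 / Real.sqrt ((2 * Real.pi) ^ n)))).congr
    (Eventually.of_forall fun x => ?_)
  simp only [noiseDensity]
  congr 2
  ring

theorem integrable_norm_pow_stdGaussian (k : ℕ) :
    Integrable (fun z : Euc n => ‖z‖ ^ k) (stdGaussian (Euc n)) := by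
  simpa using (IsGaussian.memLp_id (stdGaussian (Euc n)) k (by simp)).integrable_norm_pow'

theorem dualInequality_noise {h : ℝ} (hh : 0 ≤ h) : DualInequality (noise n h) fun _ => h := by
  have hL : LipschitzWith (Real.sqrt h).toNNReal fun z : Euc n => Real.sqrt h • z := by
    refine lipschitzWith_iff_norm_sub_le.2 fun x y => ?_
    rw [← smul_sub, norm_smul, Real.norm_of_nonneg (Real.sqrt_nonneg _),
      Real.coe_toNNReal _ (Real.sqrt_nonneg _)]
  have := (dualInequality_stdGaussian n).map zero_le_one (contDiff_const_smul _) hL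
  rw [Real.coe_toNNReal _ (Real.sqrt_nonneg _), Real.sq_sqrt hh, mul_one] at this
  exact this

end Noise

/-! ### Contraction of gradient steps. -/

section Cocoercive

variable {E : Type*} [NormedAddCommGroup E] [InnerProductSpace ℝ E]

/-- The gradient of a convex function with quadratic upper bounds is cocoercive. -/
theorem norm_sub_sq_le_of_descent {S : E → ℝ} {G : E → E} {L : ℝ} (hL : 0 < L)
    (htan : ∀ x y, S y + inner ℝ (G y) (x - y) ≤ S x)
    (hdesc : ∀ x y, S x ≤ S y + inner ℝ (G y) (x - y) + L / 2 * ‖x - y‖ ^ 2) (x y : E) :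
    ‖G x - G y‖ ^ 2 ≤ L * inner ℝ (G x - G y) (x - y) := by
  have key : ∀ x y : E,
      S x + inner ℝ (G x) (y - x) + 1 / (2 * L) * ‖G x - G y‖ ^ 2 ≤ S y := by
    intro x y
    set d := G y - G x with hd
    -- At `y - d/L`, the minimizer of the quadratic upper bound tilted by `G x`, the tangent at `x`
    -- is compared with the upper bound at `y`.
    have h1 := htan (y - (1 / L) • d) x
    have h2 := hdesc (y - (1 / L) • d) y
    have e1 : y - (1 / L) • d - x = (y - x) - (1 / L) • d := by abel
    have e2 : y - (1 / L) • d - y = -((1 / L) • d) := by abel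
    rw [e1, inner_sub_right, inner_smul_right] at h1
    rw [e2, inner_neg_right, inner_smul_right, norm_neg, norm_smul, mul_pow,
      Real.norm_of_nonneg (by positivity)] at h2
    have e3 : inner ℝ (G y) d - inner ℝ (G x) d = ‖d‖ ^ 2 := by
      rw [← inner_sub_left, ← hd, real_inner_self_eq_norm_sq]
    rw [norm_sub_rev (G x), ← hd]
    have e4 : L / 2 * ((1 / L) ^ 2 * ‖d‖ ^ 2) = 1 / (2 * L) * ‖d‖ ^ 2 := by
      field_simp
    rw [e4] at h2
    have e5 : 1 / L * ‖d‖ ^ 2 = 2 * (1 / (2 * L) * ‖d‖ ^ 2) := by field_simp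
    have e6 : 1 / L * inner ℝ (G y) d - 1 / L * inner ℝ (G x) d = 1 / L * ‖d‖ ^ 2 := by
      rw [← mul_sub, e3]
    linarith
  have h1 := key x y
  have h2 := key y x
  rw [norm_sub_rev (G y)] at h2
  have e1 : inner ℝ (G x - G y) (x - y) = -inner ℝ (G x) (y - x) - inner ℝ (G y) (x - y) := by
    rw [inner_sub_left, ← neg_sub y x, inner_neg_right, inner_neg_right]
  have h3 : 2 * (1 / (2 * L) * ‖G x - G y‖ ^ 2) ≤ inner ℝ (G x - G y) (x - y) := by
    rw [e1]; linarith
  have h4 := mul_le_mul_of_nonneg_left h3 hL.le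
  refine le_trans (le_of_eq ?_) h4
  field_simp

/-- By cocoercivity, in the expanded square `h² |G x - G y|²` is absorbed by the cross term `-2θh ⟨G
x - G y, x - y⟩` as soon as `h L ≤ 2θ`. -/
theorem norm_gradient_step_sub_le {S : E → ℝ} {G : E → E} {L : ℝ} (hL : 0 < L)
    (htan : ∀ x y, S y + inner ℝ (G y) (x - y) ≤ S x)
    (hdesc : ∀ x y, S x ≤ S y + inner ℝ (G y) (x - y) + L / 2 * ‖x - y‖ ^ 2)
    {θ h : ℝ} (hh : 0 ≤ h) (hθ : 0 ≤ θ) (hLθ : h * L ≤ 2 * θ) (x y : E) :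
    ‖(θ • x - h • G x) - (θ • y - h • G y)‖ ≤ θ * ‖x - y‖ := by
  refine le_of_sq_le_sq ?_ (by positivity)
  have e : (θ • x - h • G x) - (θ • y - h • G y) = θ • (x - y) - h • (G x - G y) := by
    simp only [smul_sub]; abel
  rw [e, norm_sub_sq_real, norm_smul, norm_smul, inner_smul_left, inner_smul_right, mul_pow,
    mul_pow, Real.norm_of_nonneg hh, Real.norm_of_nonneg hθ]
  have hc := norm_sub_sq_le_of_descent hL htan hdesc x y
  rw [real_inner_comm] at hc
  simp only [conj_trivial]
  have h0 : 0 ≤ inner ℝ (x - y) (G x - G y) := by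
    by_contra hneg
    push Not at hneg
    nlinarith [sq_nonneg ‖G x - G y‖]
  have h1 : h ^ 2 * ‖G x - G y‖ ^ 2 ≤ h * (h * L) * inner ℝ (x - y) (G x - G y) := by
    nlinarith [sq_nonneg h]
  have h2 : h * (h * L) * inner ℝ (x - y) (G x - G y) ≤
      h * (2 * θ) * inner ℝ (x - y) (G x - G y) := by gcongr
  nlinarith

end Cocoercive

/-! ### Discretized Langevin dynamics for tame potentials. -/

/-- `S` is convex with bounded gradient `G` of class `C¹` and quadratic upper bounds. -/
structure IsTamePotential {n : ℕ} (S : Euc n → ℝ) (G : Euc n → Euc n) (A L : ℝ) : Prop where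
  cont : Continuous S
  contDiff : ContDiff ℝ 1 G
  bdd : ∀ x, ‖G x‖ ≤ A
  pos : 0 < L
  tangent : ∀ x y, S y + inner ℝ (G y) (x - y) ≤ S x
  descent : ∀ x y, S x ≤ S y + inner ℝ (G y) (x - y) + L / 2 * ‖x - y‖ ^ 2

namespace IsTamePotential

variable {n : ℕ} {S : Euc n → ℝ} {G : Euc n → Euc n} {A L R h : ℝ}

theorem remainder_mem (hS : IsTamePotential S G A L) (hR : 0 ≤ R) (x y : Euc n) :
    0 ≤ (R / 2 * ‖x‖ ^ 2 + S x) - (R / 2 * ‖y‖ ^ 2 + S y) - inner ℝ (R • y + G y) (x - y) ∧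
    (R / 2 * ‖x‖ ^ 2 + S x) - (R / 2 * ‖y‖ ^ 2 + S y) - inner ℝ (R • y + G y) (x - y) ≤
      (R + L) / 2 * ‖x - y‖ ^ 2 := by
  have h1 := hS.tangent x y
  have h2 := hS.descent x y
  have h3 : ‖x‖ ^ 2 = ‖y‖ ^ 2 + 2 * inner ℝ y (x - y) + ‖x - y‖ ^ 2 := by
    have := norm_add_sq_real y (x - y)
    rwa [add_sub_cancel] at this
  rw [inner_add_left, inner_smul_left, h3]
  simp only [conj_trivial]
  have h4 : 0 ≤ R / 2 * ‖x - y‖ ^ 2 := by positivity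
  constructor <;> linarith

/-- Completing the square: seen from `y`, the weight `e^{-U(x)}` times the noise density is a
Gaussian density centred at the gradient step `y - h v`, up to a factor depending on `y` and the
exponential of minus the Taylor remainder. -/
theorem exp_mul_noiseDensity (hh : 0 < h) (x y v : Euc n) (a b : ℝ) :
    Real.exp (-a) * noiseDensity n h (x - y) =
      Real.exp (-b + h / 2 * ‖v‖ ^ 2) *
        (Real.exp (-(a - b - inner ℝ v (x - y))) * noiseDensity n h (x - (y - h • v))) := by
  have e : x - (y - h • v) = (x - y) + h • v := by abel
  rw [e]
  simp only [noiseDensity]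
  generalize (Real.sqrt h ^ n)⁻¹ * (1 / Real.sqrt ((2 * Real.pi) ^ n)) = κ
  rw [norm_add_sq_real, norm_smul, inner_smul_right, mul_pow, Real.norm_of_nonneg hh.le,
    real_inner_comm v (x - y)]
  have e2 : Real.exp (-a) * Real.exp (-‖x - y‖ ^ 2 / (2 * h)) =
      Real.exp (-b + h / 2 * ‖v‖ ^ 2) * (Real.exp (-(a - b - inner ℝ v (x - y))) *
        Real.exp (-(‖x - y‖ ^ 2 + 2 * (h * inner ℝ v (x - y)) + h ^ 2 * ‖v‖ ^ 2) / (2 * h))) := by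
    rw [← Real.exp_add, ← Real.exp_add, ← Real.exp_add]
    congr 1
    field_simp
    ring
  linear_combination κ * e2

/-- A Gaussian function which dominates all the densities that occur below. -/
theorem exists_domination (hS : IsTamePotential S G A L) (hR : 0 < R) :
    ∃ C, ∀ h, 0 ≤ h → h ≤ 1 / (8 * R) → ∀ y,
      Real.exp (-(R / 2 * ‖y‖ ^ 2 + S y) + h / 2 * ‖R • y + G y‖ ^ 2) *
        (1 + ‖R • y + G y‖ ^ 2 + ‖y‖) ≤ C * Real.exp (-(R / 16) * ‖y‖ ^ 2) := by
  have hA : 0 ≤ A := (norm_nonneg _).trans (hS.bdd 0)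
  -- Of the rate `R/2`, the linear growth of `S` costs `R/4`, the term with `h ≤ 1/(8R)` costs
  -- `R/8`, and the polynomial factor costs `R/16`; `R/16` remains. `B` comes from absorbing `t²`
  -- into `exp (R t²/16)`.
  set B := 2 + 2 * A ^ 2 + (2 * R ^ 2 + 1) * (16 / R) with hB
  refine ⟨B * Real.exp (-S 0 + A ^ 2 / R + A ^ 2 / (8 * R)), fun h hh hhR y => ?_⟩
  set t := ‖y‖ with ht
  have ht0 : 0 ≤ t := norm_nonneg y
  have hgrad : ‖R • y + G y‖ ^ 2 ≤ 2 * R ^ 2 * t ^ 2 + 2 * A ^ 2 := by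
    have h1 : ‖R • y + G y‖ ≤ R * t + A := by
      refine (norm_add_le _ _).trans (add_le_add (le_of_eq ?_) (hS.bdd y))
      rw [norm_smul, Real.norm_of_nonneg hR.le]
    have h2 := pow_le_pow_left₀ (norm_nonneg _) h1 2
    nlinarith [sq_nonneg (R * t - A)]
  have hlow : S 0 - A * t ≤ S y := by
    have h1 := hS.tangent y 0
    rw [sub_zero] at h1
    have h2 := (abs_le.1 (abs_real_inner_le_norm (G 0) y)).1
    have h3 := mul_le_mul_of_nonneg_right (hS.bdd 0) ht0
    linarith
  have hAt : A * t ≤ R / 4 * t ^ 2 + A ^ 2 / R := by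
    have e : R / 4 * t ^ 2 + A ^ 2 / R - A * t = (R * t / 2 - A) ^ 2 / R := by
      field_simp; ring
    have : 0 ≤ (R * t / 2 - A) ^ 2 / R := by positivity
    linarith
  have hhg : h / 2 * ‖R • y + G y‖ ^ 2 ≤ R / 8 * t ^ 2 + A ^ 2 / (8 * R) := by
    have h1 : h / 2 * ‖R • y + G y‖ ^ 2 ≤ 1 / (8 * R) / 2 * (2 * R ^ 2 * t ^ 2 + 2 * A ^ 2) := by
      gcongr
    refine h1.trans (le_of_eq ?_)
    field_simp
  have hexp : Real.exp (-(R / 2 * t ^ 2 + S y) + h / 2 * ‖R • y + G y‖ ^ 2) ≤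
      Real.exp (-S 0 + A ^ 2 / R + A ^ 2 / (8 * R)) * Real.exp (-(R / 8) * t ^ 2) := by
    rw [← Real.exp_add]
    refine Real.exp_le_exp.2 ?_
    linarith
  have hpoly : 1 + ‖R • y + G y‖ ^ 2 + t ≤ B * Real.exp (R / 16 * t ^ 2) := by
    have h1 : 1 + R / 16 * t ^ 2 ≤ Real.exp (R / 16 * t ^ 2) := by
      linarith [Real.add_one_le_exp (R / 16 * t ^ 2)]
    have h2 : t ≤ 1 + t ^ 2 := by nlinarith [sq_nonneg (t - 1 / 2)]
    have h3 : (2 * R ^ 2 + 1) * t ^ 2 = (2 * R ^ 2 + 1) * (16 / R) * (R / 16 * t ^ 2) := by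
      field_simp
    have h4 : 0 ≤ (2 * R ^ 2 + 1) * (16 / R) := by positivity
    have h5 : 0 ≤ R / 16 * t ^ 2 := by positivity
    have hB0 : 0 ≤ B := by positivity
    have h6 : B * (1 + R / 16 * t ^ 2) ≤ B * Real.exp (R / 16 * t ^ 2) := by gcongr
    refine le_trans ?_ h6
    have h7 : 0 ≤ (2 + 2 * A ^ 2) * (R / 16 * t ^ 2) := by positivity
    nlinarith
  calc _ ≤ (Real.exp (-S 0 + A ^ 2 / R + A ^ 2 / (8 * R)) * Real.exp (-(R / 8) * t ^ 2)) *
        (B * Real.exp (R / 16 * t ^ 2)) := by gcongr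
    _ = B * Real.exp (-S 0 + A ^ 2 / R + A ^ 2 / (8 * R)) *
        (Real.exp (-(R / 8) * t ^ 2) * Real.exp (R / 16 * t ^ 2)) := by ring
    _ = _ := by
      rw [← Real.exp_add]
      congr 2
      ring

end IsTamePotential

theorem integral_expNegMeasure {n : ℕ} {U : Euc n → ℝ} (hU : Measurable U) (φ : Euc n → ℝ) :
    ∫ x, φ x ∂(expNegMeasure U) = ∫ x, φ x * Real.exp (-U x) := by
  rw [expNegMeasure, integral_withDensity_eq_integral_toReal_smul (by fun_prop)
    (Eventually.of_forall fun _ => ENNReal.ofReal_lt_top)]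
  refine integral_congr_ae (Eventually.of_forall fun x => ?_)
  simp only [smul_eq_mul]
  rw [ENNReal.toReal_ofReal (Real.exp_pos _).le, mul_comm]

theorem integrable_expNegMeasure_iff {n : ℕ} {U : Euc n → ℝ} (hU : Measurable U)
    (φ : Euc n → ℝ) :
    Integrable φ (expNegMeasure U) ↔ Integrable fun x => φ x * Real.exp (-U x) := by
  rw [expNegMeasure, integrable_withDensity_iff (by fun_prop)
    (Eventually.of_forall fun _ => ENNReal.ofReal_lt_top)]
  simp only [ENNReal.toReal_ofReal (Real.exp_pos _).le]

/-- Bounded Lipschitz functions, with a constant. -/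
structure IsBddLip {n : ℕ} (K : NNReal) (φ : Euc n → ℝ) : Prop where
  lip : LipschitzWith K φ
  bdd : ∃ C, ∀ x, |φ x| ≤ C

theorem IsBddLip.average {n : ℕ} {K : NNReal} {φ : Euc n → ℝ} (hφ : IsBddLip K φ)
    (ν : Measure (Euc n)) [IsProbabilityMeasure ν] : IsBddLip K fun x => ∫ y, φ (x + y) ∂ν where
  bdd := hφ.bdd.imp fun C hC => average_bdd ν hC
  lip := by
    have hi : ∀ x, Integrable (fun y => φ (x + y)) ν := fun x =>
      integrable_of_continuous_bdd (hφ.lip.continuous.comp (by fun_prop))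
        (hφ.bdd.imp fun C hC y => hC _)
    refine lipschitzWith_iff_norm_sub_le.2 fun x y => ?_
    rw [← integral_sub (hi x) (hi y)]
    have := norm_integral_le_of_norm_le_const (μ := ν) (f := fun z => φ (x + z) - φ (y + z))
      (C := K * ‖x - y‖) (Eventually.of_forall fun z => by
        simpa using lipschitzWith_iff_norm_sub_le.1 hφ.lip (x + z) (y + z))
    simpa using this

theorem IsBddLip.comp {n : ℕ} {K : NNReal} {φ : Euc n → ℝ} (hφ : IsBddLip K φ)
    {T : Euc n → Euc n} {θ : NNReal} (hT : LipschitzWith θ T) :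
    IsBddLip (K * θ) fun x => φ (T x) :=
  ⟨hφ.lip.comp hT, hφ.bdd.imp fun _ hC _ => hC _⟩

namespace IsTamePotential

variable {n : ℕ} {S : Euc n → ℝ} {G : Euc n → Euc n} {A L R : ℝ}

/-- One step of the discretized Langevin dynamics, on functions. -/
noncomputable def langevinStep (R h : ℝ) (G : Euc n → Euc n) (φ : Euc n → ℝ) (x : Euc n) : ℝ :=
  ∫ a, ∫ b, φ ((x + a) - h • (R • (x + a) + G (x + a)) + b) ∂(noise n h) ∂(noise n h)

/-- One step of the dynamics changes the measure `e^{-U}` by `O(h^{3/2})` only. -/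
theorem exists_langevinStep_error (hS : IsTamePotential S G A L) (hR : 0 < R)
    [IsProbabilityMeasure (expNegMeasure fun x => R / 2 * ‖x‖ ^ 2 + S x)] :
    ∃ C, 0 ≤ C ∧ ∀ h, 0 < h → h ≤ 1 → h ≤ 1 / (8 * R) → ∀ (K : NNReal) φ, IsBddLip K φ →
      |∫ x, langevinStep R h G φ x ∂(expNegMeasure fun x => R / 2 * ‖x‖ ^ 2 + S x) -
        ∫ x, φ x ∂(expNegMeasure fun x => R / 2 * ‖x‖ ^ 2 + S x)| ≤
          K * (C * (Real.sqrt h * h)) := by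
  obtain ⟨C₁, hC₁⟩ := hS.exists_domination hR
  set γ := stdGaussian (Euc n) with hγ
  set U : Euc n → ℝ := fun x => R / 2 * ‖x‖ ^ 2 + S x with hU
  set V : Euc n → Euc n := fun y => R • y + G y with hV
  have hSc := hS.cont
  have hGc := hS.contDiff.continuous
  have hUc : Continuous U := by fun_prop
  have hVc : Continuous V := by fun_prop
  set m₁ := ∫ z, ‖z‖ ∂γ with hm₁
  have hi1 : Integrable (fun z : Euc n => ‖z‖) γ := by
    simpa using integrable_norm_pow_stdGaussian (n := n) 1
  have hi2 := integrable_norm_pow_stdGaussian (n := n) 2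
  have hi3 := integrable_norm_pow_stdGaussian (n := n) 3
  have hm₁0 : 0 ≤ m₁ := integral_nonneg fun z => norm_nonneg z
  set M := ∫ z, (‖z‖ + m₁) * (1 + ‖z‖ ^ 2) ∂γ with hM
  have hMi : Integrable (fun z : Euc n => (‖z‖ + m₁) * (1 + ‖z‖ ^ 2)) γ := by
    have : (fun z : Euc n => (‖z‖ + m₁) * (1 + ‖z‖ ^ 2)) =
        fun z => ‖z‖ + ‖z‖ ^ 3 + m₁ + m₁ * ‖z‖ ^ 2 := by
      funext z; ring
    rw [this]
    exact ((hi1.add hi3).add (integrable_const _)).add (hi2.const_mul _)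
  have hM0 : 0 ≤ M := integral_nonneg fun z => by positivity
  set I := ∫ y : Euc n, C₁ * Real.exp (-(R / 16) * ‖y‖ ^ 2) with hI
  have hIi : Integrable fun y : Euc n => C₁ * Real.exp (-(R / 16) * ‖y‖ ^ 2) :=
    (integrable_exp_neg_mul_sq_norm (by positivity)).const_mul _
  have hpi : Integrable fun x => Real.exp (-U x) := by
    have := (integrable_expNegMeasure_iff (U := U) hUc.measurable fun _ => 1).1
      (integrable_const 1)
    simpa using this
  have hL := hS.pos
  have hI0 : 0 ≤ I := integral_nonneg fun y => le_trans (by positivity)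
    (hC₁ 0 le_rfl (by positivity) y)
  refine ⟨(R + L) * M * I, by positivity, fun h hh hh1 hhR K φ hφ => ?_⟩
  set s := Real.sqrt h with hs
  have hs0 : 0 < s := Real.sqrt_pos.2 hh
  have hs2 : s ^ 2 = h := Real.sq_sqrt hh.le
  set T : Euc n → Euc n := fun y => y - h • V y with hT
  have hTc : Continuous T := by fun_prop
  obtain ⟨Cφ, hCφ⟩ := hφ.bdd
  have hφc := hφ.lip.continuous
  set Q : Euc n → ℝ := fun y => ∫ b, φ (T y + b) ∂(noise n h) with hQ
  have hQlip := hφ.average (noise n h)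
  have hQc : Continuous Q := hQlip.lip.continuous.comp hTc
  have hQb : ∀ y, |Q y| ≤ Cφ := fun y => average_bdd _ hCφ _
  have hQγ : ∀ y, Q y = ∫ z, φ (T y + s • z) ∂γ := fun y =>
    integral_noise (ψ := fun b => φ (T y + b)) (by fun_prop)
  have hφi : ∀ y, Integrable (fun z => φ (T y + s • z)) γ := fun y =>
    integrable_of_continuous_bdd (by fun_prop) ⟨Cφ, fun z => hCφ _⟩
  -- the difference as a double integral
  have hηi := integrable_noiseDensity (n := n) hh
  have hηc := continuous_noiseDensity (n := n) h
  set F : Euc n → Euc n → ℝ := fun x y =>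
    (Q y - φ x) * (Real.exp (-U x) * noiseDensity n h (y - x)) with hF
  have hFi : Integrable (Function.uncurry fun y x => F x y) (volume.prod volume) := by
    have h1 := Integrable.convolution_integrand (ContinuousLinearMap.mul ℝ ℝ) hpi hηi
      (μ := volume) (ν := volume)
    refine (h1.bdd_mul (c := Cφ + Cφ) (f := fun q : Euc n × Euc n => Q q.1 - φ q.2)
      (by fun_prop : Continuous fun q : Euc n × Euc n => Q q.1 - φ q.2).aestronglyMeasurable
      (Eventually.of_forall fun q => (abs_sub _ _).trans (add_le_add (hQb _) (hCφ _))))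
  have hdiff : ∫ x, langevinStep R h G φ x ∂(expNegMeasure U) - ∫ x, φ x ∂(expNegMeasure U) =
      ∫ y, ∫ x, F x y := by
    have hP : ∀ x, langevinStep R h G φ x = ∫ y, Q y * noiseDensity n h (y - x) := by
      intro x
      rw [integral_mul_noiseDensity_sub hh, langevinStep]
      exact integral_noise (ψ := fun a => Q (x + a)) (by fun_prop)
    have hPi : Integrable (fun x => langevinStep R h G φ x) (expNegMeasure U) :=
      integrable_of_continuous_bdd (continuous_average (noise n h) hQc ⟨Cφ, hQb⟩)
        ⟨Cφ, fun x => average_bdd _ hQb x⟩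
    rw [← integral_sub hPi (integrable_of_continuous_bdd hφc ⟨Cφ, hCφ⟩),
      integral_expNegMeasure hUc.measurable, ← integral_integral_swap hFi.swap]
    refine integral_congr_ae (Eventually.of_forall fun x => ?_)
    have hshift : Integrable fun y => noiseDensity n h (y - x) := hηi.comp_sub_right x
    have hQη : Integrable fun y => Q y * noiseDensity n h (y - x) :=
      hshift.bdd_mul (c := Cφ) hQc.aestronglyMeasurable (Eventually.of_forall hQb)
    have e : ∀ y, F x y = Real.exp (-U x) *
        (Q y * noiseDensity n h (y - x) - φ x * noiseDensity n h (y - x)) := fun y => by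
      simp only [hF]; ring
    simp only [e]
    rw [integral_const_mul, integral_sub hQη (hshift.const_mul _), integral_const_mul,
      integral_noiseDensity_sub hh, ← hP]
    ring
  rw [hdiff]
  have hr := fun x y => hS.remainder_mem hR.le x y
  have hbound : ∀ y, ‖∫ x, F x y‖ ≤ K * ((R + L) * M * (s * h)) *
      (C₁ * Real.exp (-(R / 16) * ‖y‖ ^ 2)) := by
    intro y
    set r : Euc n → ℝ := fun x => U x - U y - inner ℝ (V y) (x - y) with hrdef
    set k := Real.exp (-U y + h / 2 * ‖V y‖ ^ 2) with hk
    have hrc : Continuous r := by fun_prop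
    have e1 : ∀ x, F x y = k * (((Q y - φ x) * Real.exp (-r x)) * noiseDensity n h (x - T y)) := by
      intro x
      simp only [hF]
      rw [noiseDensity_sub_comm, exp_mul_noiseDensity hh x y (V y) (U x) (U y)]
      simp only [hk, hrdef, hT]
      ring
    simp only [e1]
    rw [integral_const_mul, integral_mul_noiseDensity_sub hh
      (fun x => (Q y - φ x) * Real.exp (-r x))]
    -- `Q y` is exactly the mean of `φ` under the noise around `T y`, so `e^{-r}` may be replaced by
    -- `e^{-r} - 1`. The two factors are then `O(√h)`, by the Lipschitz bound, and `O(h)`, by the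
    -- quadratic bound on `r`.
    have hzero : ∫ z, (Q y - φ (T y + s • z)) ∂γ = 0 := by
      rw [integral_sub (integrable_const _) (hφi y), ← hQγ y]; simp
    have hrnn : ∀ x, 0 ≤ r x := fun x => (hr x y).1
    have hexp1 : ∀ x, |Real.exp (-r x)| ≤ 1 := fun x => by
      rw [Real.abs_exp]; exact Real.exp_le_one_iff.2 (by linarith [hrnn x])
    have hwi : Integrable (fun z => (Q y - φ (T y + s • z)) * Real.exp (-r (T y + s • z))) γ :=
      integrable_of_continuous_bdd (by fun_prop) ⟨(Cφ + Cφ) * 1, fun z => by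
        rw [abs_mul]
        exact mul_le_mul ((abs_sub _ _).trans (add_le_add (hQb _) (hCφ _))) (hexp1 _)
          (abs_nonneg _) (by have := (abs_nonneg _).trans (hCφ 0); linarith)⟩
    have hzi : Integrable (fun z => Q y - φ (T y + s • z)) γ :=
      (integrable_const _).sub (hφi y)
    have e2 : ∫ z, (Q y - φ (T y + s • z)) * Real.exp (-r (T y + s • z)) ∂γ =
        ∫ z, (Q y - φ (T y + s • z)) * (Real.exp (-r (T y + s • z)) - 1) ∂γ := by
      simp only [mul_sub, mul_one]
      rw [integral_sub hwi hzi, hzero, sub_zero]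
    have hlipK : ∀ z, |Q y - φ (T y + s • z)| ≤ K * (s * (‖z‖ + m₁)) := by
      intro z
      have h1 : Q y - φ (T y + s • z) = ∫ z', (φ (T y + s • z') - φ (T y + s • z)) ∂γ := by
        rw [integral_sub (hφi y) (integrable_const _), ← hQγ y]; simp
      rw [h1]
      have hle : ∀ z', ‖φ (T y + s • z') - φ (T y + s • z)‖ ≤ K * (s * (‖z‖ + ‖z'‖)) := by
        intro z'
        refine (lipschitzWith_iff_norm_sub_le.1 hφ.lip _ _).trans ?_
        refine mul_le_mul_of_nonneg_left ?_ K.2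
        rw [add_sub_add_left_eq_sub, ← smul_sub, norm_smul, Real.norm_of_nonneg hs0.le]
        refine mul_le_mul_of_nonneg_left ?_ hs0.le
        rw [add_comm]
        exact norm_sub_le _ _
      refine (norm_integral_le_of_norm_le ((((integrable_const _).add hi1).const_mul s).const_mul
        (K : ℝ)) (Eventually.of_forall hle)).trans (le_of_eq ?_)
      simp only [Pi.add_apply]
      rw [integral_const_mul, integral_const_mul, integral_add (integrable_const _) hi1]
      simp [hm₁]
    have hrle : ∀ z, |Real.exp (-r (T y + s • z)) - 1| ≤
        (R + L) * (h * (1 + ‖V y‖ ^ 2) * (1 + ‖z‖ ^ 2)) := by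
      intro z
      set x := T y + s • z with hx
      have h1 : Real.exp (-r x) ≤ 1 := Real.exp_le_one_iff.2 (by linarith [hrnn x])
      have h2 := Real.one_sub_le_exp_neg (r x)
      rw [abs_of_nonpos (by linarith)]
      have h3 := (hr x y).2
      have e3 : x - y = s • z - h • V y := by simp only [hx, hT]; abel
      have h4 : ‖x - y‖ ^ 2 ≤ 2 * (h * ‖z‖ ^ 2) + 2 * (h * ‖V y‖ ^ 2) := by
        have h5 : ‖x - y‖ ≤ s * ‖z‖ + h * ‖V y‖ := by
          rw [e3]
          refine (norm_sub_le _ _).trans (le_of_eq ?_)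
          rw [norm_smul, norm_smul, Real.norm_of_nonneg hs0.le, Real.norm_of_nonneg hh.le]
        have h6 := pow_le_pow_left₀ (norm_nonneg _) h5 2
        have h7 : (h * ‖V y‖) ^ 2 ≤ h * ‖V y‖ ^ 2 := by
          rw [mul_pow]
          refine mul_le_mul_of_nonneg_right ?_ (sq_nonneg _)
          nlinarith
        have h8 : (s * ‖z‖) ^ 2 = h * ‖z‖ ^ 2 := by rw [mul_pow, hs2]
        nlinarith [sq_nonneg (s * ‖z‖ - h * ‖V y‖)]
      have h9 : 0 ≤ h * (1 + ‖V y‖ ^ 2 * ‖z‖ ^ 2) := by positivity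
      have h10 : (R + L) / 2 * ‖x - y‖ ^ 2 ≤
          (R + L) / 2 * (2 * (h * ‖z‖ ^ 2) + 2 * (h * ‖V y‖ ^ 2)) := by gcongr
      have h11 : 0 ≤ (R + L) * (h * (1 + ‖V y‖ ^ 2 * ‖z‖ ^ 2)) := by positivity
      have h12 : r x ≤ (R + L) / 2 * ‖x - y‖ ^ 2 := h3
      linarith
    have e3 : ‖∫ z, (Q y - φ (T y + s • z)) * (Real.exp (-r (T y + s • z)) - 1) ∂γ‖ ≤
        K * ((R + L) * M * (s * h)) * (1 + ‖V y‖ ^ 2) := by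
      have hle : ∀ z, ‖(Q y - φ (T y + s • z)) * (Real.exp (-r (T y + s • z)) - 1)‖ ≤
          (K * ((R + L) * (s * h)) * (1 + ‖V y‖ ^ 2)) * ((‖z‖ + m₁) * (1 + ‖z‖ ^ 2)) := by
        intro z
        rw [norm_mul]
        refine (mul_le_mul (hlipK z) (hrle z) (abs_nonneg _) (by positivity)).trans (le_of_eq ?_)
        ring
      refine (norm_integral_le_of_norm_le (hMi.const_mul _) (Eventually.of_forall hle)).trans
        (le_of_eq ?_)
      rw [integral_const_mul, ← hM]
      ring
    rw [e2, norm_mul, Real.norm_of_nonneg (Real.exp_pos _).le]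
    have hdom := hC₁ h hh.le hhR y
    calc k * ‖∫ z, (Q y - φ (T y + s • z)) * (Real.exp (-r (T y + s • z)) - 1) ∂γ‖
        ≤ k * (K * ((R + L) * M * (s * h)) * (1 + ‖V y‖ ^ 2)) := by
          gcongr
      _ ≤ K * ((R + L) * M * (s * h)) * (k * (1 + ‖V y‖ ^ 2 + ‖y‖)) := by
          have h1 : 0 ≤ K * ((R + L) * M * (s * h)) * (k * ‖y‖) := by
            have := Real.exp_pos (-U y + h / 2 * ‖V y‖ ^ 2)
            positivity
          linarith
      _ ≤ _ := by gcongr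
  refine (norm_integral_le_of_norm_le (hIi.const_mul _) (Eventually.of_forall hbound)).trans
    (le_of_eq ?_)
  rw [integral_const_mul, ← hI]
  ring

/-- Each step shrinks the Lipschitz constant of a test function by `θ = 1 - hR`, so the errors
`O(h^{3/2})` sum as a geometric series to `O(√h)`. The law of the dynamics retains the dual
inequality with weights `1/R` throughout. -/
theorem exists_approximation (hS : IsTamePotential S G A L) (hR : 0 < R)
    [IsProbabilityMeasure (expNegMeasure fun x => R / 2 * ‖x‖ ^ 2 + S x)] :
    ∃ C, 0 ≤ C ∧ ∃ h₀, 0 < h₀ ∧ ∀ h, 0 < h → h ≤ h₀ → ∃ ν : Measure (Euc n),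
      IsProbabilityMeasure ν ∧ DualInequality ν (fun _ => 1 / R) ∧
      ∀ (K : NNReal) φ, IsBddLip K φ →
        |∫ x, φ x ∂ν - ∫ x, φ x ∂(expNegMeasure fun x => R / 2 * ‖x‖ ^ 2 + S x)| ≤
          K * (C * Real.sqrt h) := by
  obtain ⟨C, hC0, hC⟩ := hS.exists_langevinStep_error hR
  obtain ⟨C₁, hC₁⟩ := hS.exists_domination hR
  set U : Euc n → ℝ := fun x => R / 2 * ‖x‖ ^ 2 + S x with hU
  have hSc := hS.cont
  have hUc : Continuous U := by fun_prop
  have hL := hS.pos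
  set μ := expNegMeasure U with hμ
  have hnorm : Integrable (fun x : Euc n => ‖x‖) μ := by
    rw [hμ, integrable_expNegMeasure_iff hUc.measurable]
    refine Integrable.mono' ((integrable_exp_neg_mul_sq_norm (b := R / 16)
      (by positivity)).const_mul C₁)
      (by fun_prop : Continuous fun x => ‖x‖ * Real.exp (-U x)).aestronglyMeasurable
      (Eventually.of_forall fun y => ?_)
    -- The case `h = 0` of the domination gives a finite first moment of `μ`; the summand `‖y‖`
    -- there serves this purpose.
    have h1 := hC₁ 0 le_rfl (by positivity) y
    simp only [zero_div, zero_mul, add_zero] at h1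
    rw [norm_mul, norm_norm, Real.norm_of_nonneg (Real.exp_pos _).le, mul_comm]
    refine le_trans (mul_le_mul_of_nonneg_left ?_ (Real.exp_pos _).le) h1
    have : 0 ≤ ‖R • y + G y‖ ^ 2 := by positivity
    linarith
  set D := ∫ x, ‖x‖ ∂μ with hD
  have hD0 : 0 ≤ D := integral_nonneg fun x => norm_nonneg x
  -- `D` accounts for the starting Dirac mass and `C / R` for the geometric series. The bounds `h ≤
  -- 1/L` and `h ≤ 1/(8R)` give `h L ≤ 1 ≤ 2θ`.
  refine ⟨D + C / R, by positivity, min (min 1 (1 / (8 * R))) (1 / L), by positivity,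
    fun h hh hle => ?_⟩
  have hh1 : h ≤ 1 := hle.trans ((min_le_left _ _).trans (min_le_left _ _))
  have hhR : h ≤ 1 / (8 * R) := hle.trans ((min_le_left _ _).trans (min_le_right _ _))
  have hhL : h ≤ 1 / L := hle.trans (min_le_right _ _)
  have hhR' : h * R ≤ 1 / 8 := by
    rw [le_div_iff₀ (by positivity)] at hhR; linarith
  have hhL' : h * L ≤ 1 := by
    rwa [le_div_iff₀ hL] at hhL
  have hhR0 : 0 < h * R := by positivity
  set θ : ℝ := 1 - h * R with hθ
  have hθ0 : 0 ≤ θ := by linarith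
  set T : Euc n → Euc n := fun y => y - h • (R • y + G y) with hT
  have hTlip : LipschitzWith θ.toNNReal T := by
    refine lipschitzWith_iff_norm_sub_le.2 fun x y => ?_
    have e : ∀ y, T y = θ • y - h • G y := fun y => by
      simp only [hT, hθ, smul_add, sub_smul, one_smul, mul_smul]; abel
    rw [e, e, Real.coe_toNNReal _ hθ0]
    exact norm_gradient_step_sub_le hL hS.tangent hS.descent hh.le hθ0 (by linarith) x y
  have hTd : ContDiff ℝ 1 T := by
    have := hS.contDiff
    fun_prop
  have hGc := hS.contDiff.continuous
  have hTc : Continuous T := hTd.continuous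
  have hP : ∀ (K : NNReal) φ, IsBddLip K φ →
      IsBddLip (K * θ.toNNReal) (langevinStep R h G φ) := by
    intro K φ hφ
    exact ((hφ.average (noise n h)).comp hTlip).average (noise n h)
  have hiter : ∀ k : ℕ, ∃ ν : Measure (Euc n), IsProbabilityMeasure ν ∧
      DualInequality ν (fun _ => 1 / R) ∧ ∀ (K : NNReal) φ, IsBddLip K φ →
        |∫ x, φ x ∂ν - ∫ x, φ x ∂μ| ≤ K * (θ ^ k * D + C / R * Real.sqrt h) := by
    intro k
    induction k with
    | zero =>
      refine ⟨Measure.dirac 0, inferInstance, dualInequality_dirac 0 fun _ => by positivity,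
        fun K φ hφ => ?_⟩
      have hφi : Integrable φ μ := integrable_of_continuous_bdd hφ.lip.continuous hφ.bdd
      have e : ∫ x, φ x ∂(Measure.dirac 0) - ∫ x, φ x ∂μ = ∫ x, (φ 0 - φ x) ∂μ := by
        rw [integral_sub (integrable_const _) hφi]; simp
      rw [e]
      refine (norm_integral_le_of_norm_le (f := fun x => φ 0 - φ x) (hnorm.const_mul (K : ℝ))
        (Eventually.of_forall fun x => ?_)).trans ?_
      · simpa using lipschitzWith_iff_norm_sub_le.1 hφ.lip 0 x
      · rw [integral_const_mul, ← hD, pow_zero, one_mul]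
        exact mul_le_mul_of_nonneg_left (le_add_of_nonneg_right (by positivity)) K.2
    | succ k ih =>
      obtain ⟨ν, hν, hDI, hclose⟩ := ih
      have hmap : IsProbabilityMeasure (((ν.conv (noise n h)).map T)) :=
        Measure.isProbabilityMeasure_map hTc.measurable.aemeasurable
      refine ⟨((ν.conv (noise n h)).map T).conv (noise n h), inferInstance, ?_,
        fun K φ hφ => ?_⟩
      · have h1 := hDI.conv (dualInequality_noise (n := n) hh.le) fun _ => by positivity
        have h2 := DualInequality.map (c := 1 / R + h) (by positivity) h1 hTd hTlip
        refine (h2.conv (dualInequality_noise (n := n) hh.le) fun _ => by positivity).mono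
          fun i => ?_
        simp only [Pi.add_apply, Real.coe_toNNReal _ hθ0]
        -- Noise, contraction and noise again: the drift `h` is matched by total variance `2h`.
        -- Splitting the noise symmetrically makes the resulting weight at most `1/R`, with no loss.
        have e : θ ^ 2 * (1 / R + h) + h = 1 / R - h * (h * R) * (1 - h * R) := by
          simp only [hθ]; field_simp; ring
        rw [e]
        have : 0 ≤ h * (h * R) * (1 - h * R) := by positivity
        linarith
      · have hφc := hφ.lip.continuous
        have hav := hφ.average (noise n h)
        have e : ∫ x, φ x ∂(((ν.conv (noise n h)).map T).conv (noise n h)) =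
            ∫ x, langevinStep R h G φ x ∂ν := by
          rw [integral_conv (integrable_of_continuous_bdd hφc hφ.bdd),
            integral_map hTc.measurable.aemeasurable hav.lip.continuous.aestronglyMeasurable,
            integral_conv (f := fun x => ∫ y, φ (T x + y) ∂(noise n h))
              (integrable_of_continuous_bdd (hav.lip.continuous.comp hTc)
              (hav.bdd.imp fun _ hC _ => hC _))]
          rfl
        rw [e]
        have h1 := hclose _ _ (hP K φ hφ)
        have h2 := hC h hh hh1 hhR K φ hφ
        refine (abs_sub_le _ _ _).trans ((add_le_add h1 h2).trans (le_of_eq ?_))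
        rw [NNReal.coe_mul, Real.coe_toNNReal _ hθ0, pow_succ]
        simp only [hθ]
        field_simp
        ring
  -- Run long enough that the memory of the starting point is below the discretization error.
  obtain ⟨k, hk⟩ := exists_pow_lt_of_lt_one (Real.sqrt_pos.2 hh) (by linarith : θ < 1)
  obtain ⟨ν, hν, hDI, hclose⟩ := hiter k
  refine ⟨ν, hν, hDI, fun K φ hφ => (hclose K φ hφ).trans ?_⟩
  refine mul_le_mul_of_nonneg_left ?_ K.2
  have := mul_le_mul_of_nonneg_right hk.le hD0
  linarith

/-- As the step size tends to `0`, the laws of the dynamics converge on bounded Lipschitz functions,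
hence weakly, and the integrands of the dual inequality are bounded and continuous. -/
theorem dualInequality (hS : IsTamePotential S G A L) (hR : 0 < R)
    [hprob : IsProbabilityMeasure (expNegMeasure fun x => R / 2 * ‖x‖ ^ 2 + S x)] :
    DualInequality (expNegMeasure fun x => R / 2 * ‖x‖ ^ 2 + S x) fun _ => 1 / R := by
  obtain ⟨C, hC0, h₀, hh₀, hC⟩ := hS.exists_approximation hR
  have hpos : ∀ j : ℕ, 0 < h₀ / (j + 1) := fun j => by positivity
  choose ν hν hDI hclose using fun j : ℕ => hC (h₀ / (j + 1)) (hpos j)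
    (div_le_self hh₀.le (by linarith [(Nat.cast_nonneg j : (0 : ℝ) ≤ j)]))
  have hlim0 : Tendsto (fun j : ℕ => Real.sqrt (h₀ / (j + 1))) atTop (𝓝 0) := by
    have h1 : Tendsto (fun j : ℕ => h₀ / ((j : ℝ) + 1)) atTop (𝓝 0) :=
      tendsto_const_nhds.div_atTop
        (tendsto_atTop_add_const_right _ _ tendsto_natCast_atTop_atTop)
    have h2 := (Real.continuous_sqrt.tendsto 0).comp h1
    rwa [Real.sqrt_zero] at h2
  let νs : ℕ → ProbabilityMeasure (Euc n) := fun j => ⟨ν j, hν j⟩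
  let μ : ProbabilityMeasure (Euc n) :=
    ⟨expNegMeasure fun x => R / 2 * ‖x‖ ^ 2 + S x, hprob⟩
  have hw : Tendsto νs atTop (𝓝 μ) := by
    refine tendsto_iff_forall_lipschitz_integral_tendsto.2 ?_
    rintro φ ⟨B, hB⟩ ⟨K, hK⟩
    have hφ : IsBddLip K φ := ⟨hK, ⟨B + |φ 0|, fun x => by
      have h1 := hB x 0
      rw [Real.dist_eq] at h1
      have h2 := abs_sub_abs_le_abs_sub (φ x) (φ 0)
      linarith⟩⟩
    rw [tendsto_iff_norm_sub_tendsto_zero]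
    have h1 := (hlim0.const_mul C).const_mul (K : ℝ)
    simp only [mul_zero] at h1
    exact squeeze_zero (fun j => norm_nonneg _) (fun j => hclose j K φ hφ) h1
  refine DualInequality.of_tendsto (l := atTop) hDI fun φ hφ hb => ?_
  obtain ⟨B, hB⟩ := hb
  exact ProbabilityMeasure.tendsto_iff_forall_integral_tendsto.1 hw
    (BoundedContinuousFunction.ofNormedAddCommGroup φ hφ B hB)

end IsTamePotential

/-! ### Log-sum-exp functions as tame potentials. -/

theorem Real.exp_le_add_exp_sq (t : ℝ) : Real.exp t ≤ t + Real.exp (t ^ 2) := by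
  rcases le_or_gt |t| 1 with h | h
  · have h1 := (abs_le.1 (Real.abs_exp_sub_one_sub_id_le h)).2
    have h2 := Real.add_one_le_exp (t ^ 2)
    linarith
  · rcases lt_abs.1 h with h | h
    · have h1 : Real.exp t ≤ Real.exp (t ^ 2) := Real.exp_le_exp.2 (by nlinarith)
      linarith
    · have h1 : Real.exp t ≤ 1 := Real.exp_le_one_iff.2 (by linarith)
      have h2 := Real.add_one_le_exp (t ^ 2)
      nlinarith

section LogSumExp

variable {ι : Type*} [Fintype ι]

theorem le_log_sum_mul_exp {w t : ι → ℝ} (hw : ∀ i, 0 ≤ w i) (hw1 : ∑ i, w i = 1) :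
    ∑ i, w i * t i ≤ Real.log (∑ i, w i * Real.exp (t i)) := by
  have h := convexOn_exp.map_sum_le (t := Finset.univ) (w := w) (p := t)
    (fun i _ => hw i) hw1 (fun _ _ => mem_univ _)
  simp only [smul_eq_mul] at h
  exact (Real.le_log_iff_exp_le ((Real.exp_pos _).trans_le h)).2 h

/-- A Hoeffding-type bound: in `e^s ≤ s + e^{s²}`, applied to the centred values, the linear terms
average to zero. It replaces a computation of the Hessian of log-sum-exp. -/
theorem log_sum_mul_exp_le {w t : ι → ℝ} (hw : ∀ i, 0 ≤ w i) (hw1 : ∑ i, w i = 1) {M : ℝ}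
    (hM : ∀ i, |t i - ∑ j, w j * t j| ≤ M) :
    Real.log (∑ i, w i * Real.exp (t i)) ≤ ∑ i, w i * t i + M ^ 2 := by
  set τ := ∑ j, w j * t j with hτ
  have h1 : ∑ i, w i * Real.exp (t i) ≤ Real.exp (τ + M ^ 2) := by
    have h2 : ∀ i, w i * Real.exp (t i) ≤
        Real.exp τ * (w i * t i - w i * τ + w i * Real.exp (M ^ 2)) := by
      intro i
      have h3 := Real.exp_le_add_exp_sq (t i - τ)
      have h4 : Real.exp ((t i - τ) ^ 2) ≤ Real.exp (M ^ 2) := by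
        refine Real.exp_le_exp.2 ?_
        rw [← sq_abs]
        exact pow_le_pow_left₀ (abs_nonneg _) (hM i) 2
      have h5 : Real.exp (t i) = Real.exp τ * Real.exp (t i - τ) := by
        rw [← Real.exp_add]; congr 1; ring
      rw [h5]
      have h6 := mul_le_mul_of_nonneg_left (h3.trans (add_le_add_right h4 _))
        (mul_nonneg (Real.exp_pos τ).le (hw i))
      linarith
    refine (Finset.sum_le_sum fun i _ => h2 i).trans (le_of_eq ?_)
    rw [← Finset.mul_sum, Finset.sum_add_distrib, Finset.sum_sub_distrib, ← Finset.sum_mul,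
      ← Finset.sum_mul, hw1, ← hτ, Real.exp_add]
    ring
  have hpos : 0 < ∑ i, w i * Real.exp (t i) := by
    obtain ⟨i, -, hi⟩ : ∃ i ∈ Finset.univ, 0 < w i := by
      by_contra hne
      push Not at hne
      have := Finset.sum_nonpos hne
      rw [hw1] at this
      linarith
    exact Finset.sum_pos' (fun i _ => mul_nonneg (hw i) (Real.exp_pos _).le)
      ⟨i, Finset.mem_univ _, mul_pos hi (Real.exp_pos _)⟩
  exact (Real.log_le_iff_le_exp hpos).2 h1

variable {n : ℕ}

/-- The normalized logarithm of a sum of exponentials of affine functions. -/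
noncomputable def logSumExp (β : ℝ) (a : ι → Euc n) (b : ι → ℝ) (x : Euc n) : ℝ :=
  1 / β * Real.log (∑ i, Real.exp (β * (b i + inner ℝ (a i) x)))

/-- The weights in the gradient of `logSumExp`. -/
noncomputable def softmaxWeight (β : ℝ) (a : ι → Euc n) (b : ι → ℝ) (i : ι) (x : Euc n) : ℝ :=
  Real.exp (β * (b i + inner ℝ (a i) x)) / ∑ i, Real.exp (β * (b i + inner ℝ (a i) x))

variable [Nonempty ι]

theorem sum_exp_pos (t : ι → ℝ) : 0 < ∑ i, Real.exp (t i) :=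
  Finset.sum_pos (fun _ _ => Real.exp_pos _) Finset.univ_nonempty

/-- Increments are logarithms of weighted exponential means, so convexity of `exp` gives the tangent
bound and the Hoeffding-type bound gives the descent bound. Deviations are at most `2βA‖x - y‖`,
whence `8βA²`; the `+ 1` only makes the constant positive. -/
theorem isTamePotential_logSumExp {β : ℝ} (hβ : 0 < β) (a : ι → Euc n) (b : ι → ℝ) :
    IsTamePotential (logSumExp β a b) (fun x => ∑ i, softmaxWeight β a b i x • a i)
      (∑ i, ‖a i‖) (8 * β * (∑ i, ‖a i‖) ^ 2 + 1) := by
  set A := ∑ i, ‖a i‖ with hA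
  have hA0 : 0 ≤ A := Finset.sum_nonneg fun i _ => norm_nonneg _
  have haA : ∀ i, ‖a i‖ ≤ A := fun i =>
    Finset.single_le_sum (f := fun i => ‖a i‖) (fun i _ => norm_nonneg _) (Finset.mem_univ i)
  have hZ : ∀ x : Euc n, 0 < ∑ i, Real.exp (β * (b i + inner ℝ (a i) x)) := fun x => sum_exp_pos _
  have hw0 : ∀ i x, 0 ≤ softmaxWeight β a b i x := fun i x =>
    div_nonneg (Real.exp_pos _).le (hZ x).le
  have hw1 : ∀ x, ∑ i, softmaxWeight β a b i x = 1 := fun x => by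
    simp only [softmaxWeight]
    rw [← Finset.sum_div, div_self (hZ x).ne']
  have hdiff : ∀ x y, logSumExp β a b x - logSumExp β a b y =
      1 / β * Real.log (∑ i, softmaxWeight β a b i y * Real.exp (β * inner ℝ (a i) (x - y))) := by
    intro x y
    rw [logSumExp, logSumExp, ← mul_sub, ← Real.log_div (hZ x).ne' (hZ y).ne']
    congr 2
    rw [Finset.sum_div]
    refine Finset.sum_congr rfl fun i _ => ?_
    rw [softmaxWeight, div_mul_eq_mul_div, ← Real.exp_add, inner_sub_right]
    congr 2
    ring
  have hinner : ∀ x y : Euc n, inner ℝ (∑ i, softmaxWeight β a b i y • a i) (x - y) =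
      1 / β * ∑ i, softmaxWeight β a b i y * (β * inner ℝ (a i) (x - y)) := by
    intro x y
    rw [sum_inner, Finset.mul_sum]
    refine Finset.sum_congr rfl fun i _ => ?_
    rw [real_inner_smul_left]
    field_simp
  refine ⟨?_, ?_, fun x => ?_, by positivity, fun x y => ?_, fun x y => ?_⟩
  · unfold logSumExp
    refine continuous_const.mul (Continuous.log (by fun_prop) fun x => (hZ x).ne')
  · refine ContDiff.sum fun i _ => ?_
    suffices h : ContDiff ℝ 1 (softmaxWeight β a b i) from
      h.smul (contDiff_const (c := a i))
    unfold softmaxWeight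
    have hi : ∀ i, ContDiff ℝ 1 fun x : Euc n => inner ℝ (a i) x := fun i =>
      contDiff_const.inner ℝ contDiff_id
    exact ContDiff.div (contDiff_const.mul (contDiff_const.add (hi i))).exp
      (ContDiff.sum fun j _ => (contDiff_const.mul (contDiff_const.add (hi j))).exp)
      fun x => (hZ x).ne'
  · refine (norm_sum_le _ _).trans (Finset.sum_le_sum fun i _ => ?_)
    rw [norm_smul, Real.norm_of_nonneg (hw0 i x)]
    refine mul_le_of_le_one_left (norm_nonneg _) ?_
    rw [← hw1 x]
    exact Finset.single_le_sum (f := fun i => softmaxWeight β a b i x) (fun i _ => hw0 i x)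
      (Finset.mem_univ i)
  · have h1 := le_log_sum_mul_exp (t := fun i => β * inner ℝ (a i) (x - y)) (fun i => hw0 i y)
      (hw1 y)
    have h2 := mul_le_mul_of_nonneg_left h1 (by positivity : 0 ≤ 1 / β)
    rw [← hinner, ← hdiff] at h2
    linarith
  · have ht : ∀ i, |β * inner ℝ (a i) (x - y)| ≤ β * (A * ‖x - y‖) := fun i => by
      rw [abs_mul, abs_of_pos hβ]
      refine mul_le_mul_of_nonneg_left ((abs_real_inner_le_norm _ _).trans ?_) hβ.le
      exact mul_le_mul_of_nonneg_right (haA i) (norm_nonneg _)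
    have hτ : |∑ i, softmaxWeight β a b i y * (β * inner ℝ (a i) (x - y))| ≤
        β * (A * ‖x - y‖) := by
      refine (Finset.abs_sum_le_sum_abs _ _).trans ?_
      calc ∑ i, |softmaxWeight β a b i y * (β * inner ℝ (a i) (x - y))|
          ≤ ∑ i, softmaxWeight β a b i y * (β * (A * ‖x - y‖)) := by
            refine Finset.sum_le_sum fun i _ => ?_
            rw [abs_mul, abs_of_nonneg (hw0 i y)]
            exact mul_le_mul_of_nonneg_left (ht i) (hw0 i y)
        _ = _ := by rw [← Finset.sum_mul, hw1, one_mul]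
    have h1 := log_sum_mul_exp_le (t := fun i => β * inner ℝ (a i) (x - y)) (fun i => hw0 i y)
      (hw1 y) (M := β * (A * ‖x - y‖) + β * (A * ‖x - y‖))
      fun i => (abs_sub _ _).trans (add_le_add (ht i) hτ)
    have h2 := mul_le_mul_of_nonneg_left h1 (by positivity : 0 ≤ 1 / β)
    rw [← hdiff, mul_add, ← hinner] at h2
    have e : 1 / β * (β * (A * ‖x - y‖) + β * (A * ‖x - y‖)) ^ 2 =
        8 * β * A ^ 2 / 2 * ‖x - y‖ ^ 2 := by
      field_simp; ring
    rw [e] at h2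
    have h3 : 0 ≤ 1 / 2 * ‖x - y‖ ^ 2 := by positivity
    linarith

theorem le_logSumExp {β : ℝ} (hβ : 0 < β) (a : ι → Euc n) (b : ι → ℝ) (i : ι) (x : Euc n) :
    b i + inner ℝ (a i) x ≤ logSumExp β a b x := by
  rw [logSumExp, one_div, ← div_eq_inv_mul, le_div_iff₀ hβ, Real.le_log_iff_exp_le (sum_exp_pos _),
    mul_comm]
  exact Finset.single_le_sum (f := fun i => Real.exp (β * (b i + inner ℝ (a i) x)))
    (fun i _ => (Real.exp_pos _).le) (Finset.mem_univ i)

theorem logSumExp_le {β : ℝ} (hβ : 0 < β) (a : ι → Euc n) (b : ι → ℝ) (x : Euc n) {v : ℝ}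
    (hv : ∀ i, b i + inner ℝ (a i) x ≤ v) :
    logSumExp β a b x ≤ v + Real.log (Fintype.card ι) / β := by
  have hc : (0 : ℝ) < Fintype.card ι := by exact_mod_cast Fintype.card_pos
  have h1 : ∑ i, Real.exp (β * (b i + inner ℝ (a i) x)) ≤ Fintype.card ι * Real.exp (β * v) := by
    refine (Finset.sum_le_sum fun i _ => Real.exp_le_exp.2
      (mul_le_mul_of_nonneg_left (hv i) hβ.le)).trans (le_of_eq ?_)
    simp
  have h2 := Real.log_le_log (sum_exp_pos _) h1
  rw [Real.log_mul hc.ne' (Real.exp_pos _).ne', Real.log_exp] at h2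
  rw [logSumExp, one_div, ← div_eq_inv_mul, div_le_iff₀ hβ, add_mul, div_mul_cancel₀ _ hβ.ne']
  linarith

end LogSumExp

/-! ### General uniformly log-concave measures. -/

theorem IsTamePotential.add_const {n : ℕ} {S : Euc n → ℝ} {G : Euc n → Euc n} {A L : ℝ}
    (hS : IsTamePotential S G A L) (c : ℝ) : IsTamePotential (fun x => S x + c) G A L where
  cont := hS.cont.add continuous_const
  contDiff := hS.contDiff
  bdd := hS.bdd
  pos := hS.pos
  tangent x y := by linarith [hS.tangent x y]
  descent x y := by linarith [hS.descent x y]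

/-- The lower quadratic bound that follows from a lower bound on the Hessian. -/
theorem HessianGE.quadratic_lower_bound {n : ℕ} {U : Euc n → ℝ} {R : ℝ} (hU : ContDiff ℝ ∞ U)
    (hH : HessianGE U R) (x y : Euc n) :
    U y + fderiv ℝ U y (x - y) + R / 2 * ‖x - y‖ ^ 2 ≤ U x := by
  set d := x - y with hd
  have hUd : Differentiable ℝ U := hU.differentiable (by simp)
  have hU' : ContDiff ℝ ∞ (fderiv ℝ U) := hU.fderiv_right (by simp)
  have hU'd : Differentiable ℝ (fderiv ℝ U) := hU'.differentiable (by simp)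
  have hline : ∀ t : ℝ, HasDerivAt (fun t : ℝ => y + t • d) d t := fun t => by
    simpa using ((hasDerivAt_id t).smul_const d).const_add y
  set φ' : ℝ → ℝ := fun t => fderiv ℝ U (y + t • d) d - R * ‖d‖ ^ 2 * t with hφ'
  have h1 : ∀ t : ℝ, HasDerivAt (fun t : ℝ => U (y + t • d) - R / 2 * ‖d‖ ^ 2 * t ^ 2)
      (φ' t) t := by
    intro t
    have h2 := ((hUd _).hasFDerivAt.comp_hasDerivAt t (hline t)).sub
      ((hasDerivAt_pow 2 t).const_mul (R / 2 * ‖d‖ ^ 2))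
    refine h2.congr_deriv ?_
    simp only [hφ']
    push_cast
    ring
  have h2 : ∀ t : ℝ, HasDerivAt φ'
      (fderiv ℝ (fderiv ℝ U) (y + t • d) d d - R * ‖d‖ ^ 2) t := by
    intro t
    have h3 := ((hU'd _).hasFDerivAt.comp_hasDerivAt t (hline t)).clm_apply (hasDerivAt_const t d)
    have h4 := h3.sub ((hasDerivAt_id t).const_mul (R * ‖d‖ ^ 2))
    refine h4.congr_deriv ?_
    simp
  have hmono : Monotone φ' := monotone_of_deriv_nonneg (fun t => (h2 t).differentiableAt)
    fun t => by rw [(h2 t).deriv]; linarith [hH (y + t • d) d]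
  obtain ⟨c, hc, he⟩ := exists_hasDerivAt_eq_slope
    (fun t : ℝ => U (y + t • d) - R / 2 * ‖d‖ ^ 2 * t ^ 2) φ' zero_lt_one
    (fun t _ => (h1 t).continuousAt.continuousWithinAt) fun t _ => h1 t
  have h5 := hmono hc.1.le
  have h6 : φ' c = U x - R / 2 * ‖d‖ ^ 2 - U y := by
    rw [he]; simp [hd]
  have h7 : φ' 0 = fderiv ℝ U y d := by simp [hφ']
  linarith

theorem isProbabilityMeasure_expNegMeasure {n : ℕ} {U : Euc n → ℝ}
    (hi : Integrable fun x => Real.exp (-U x)) (h1 : ∫ x, Real.exp (-U x) = 1) :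
    IsProbabilityMeasure (expNegMeasure U) := by
  refine ⟨?_⟩
  rw [expNegMeasure, withDensity_apply _ MeasurableSet.univ, setLIntegral_univ,
    ← ofReal_integral_eq_lintegral_ofReal hi (Eventually.of_forall fun x => (Real.exp_pos _).le),
    h1, ENNReal.ofReal_one]

/-- The dual inequality for uniformly log-concave measures. -/
theorem dualInequality_expNegMeasure {n : ℕ} {U : Euc n → ℝ} {R : ℝ} (hR : 0 < R)
    (hU : ContDiff ℝ ∞ U) (hH : HessianGE U R) [hprob : IsProbabilityMeasure (expNegMeasure U)] :
    DualInequality (expNegMeasure U) fun _ => 1 / R := by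
  have hUc := hU.continuous
  have hU'c : Continuous (fderiv ℝ U) := hU.continuous_fderiv (by simp)
  set V : Euc n → ℝ := fun x => U x - R / 2 * ‖x‖ ^ 2 with hV
  set grad : Euc n → Euc n := fun y => (InnerProductSpace.toDual ℝ (Euc n)).symm (fderiv ℝ U y)
    - R • y with hgrad
  have hgc : Continuous grad := by fun_prop
  have hVc : Continuous V := by fun_prop
  have htan : ∀ x y, V y + inner ℝ (grad y) (x - y) ≤ V x := by
    intro x y
    have h1 := hH.quadratic_lower_bound hU x y
    have h3 : ‖x‖ ^ 2 = ‖y‖ ^ 2 + 2 * inner ℝ y (x - y) + ‖x - y‖ ^ 2 := by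
      have := norm_add_sq_real y (x - y)
      rwa [add_sub_cancel] at this
    simp only [hV, hgrad]
    rw [inner_sub_left, real_inner_smul_left, InnerProductSpace.toDual_symm_apply, h3]
    linarith
  -- The convex function `V` is the supremum of its tangents at a dense set of points. The first `N
  -- + 1` of them enter a log-sum-exp with `β = N + 1`, which exceeds `V` by at most `log (N + 1) /
  -- (N + 1)`.
  set y : ℕ → Euc n := TopologicalSpace.denseSeq (Euc n) with hy
  set a : ∀ N : ℕ, Fin (N + 1) → Euc n := fun N j => grad (y j) with ha
  set b : ∀ N : ℕ, Fin (N + 1) → ℝ := fun N j => V (y j) - inner ℝ (grad (y j)) (y j) with hb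
  have hl : ∀ N (j : Fin (N + 1)) x, b N j + inner ℝ (a N j) x =
      V (y j) + inner ℝ (grad (y j)) (x - y j) := by
    intro N j x
    simp only [hb, ha, inner_sub_right]; ring
  set S : ℕ → Euc n → ℝ := fun N => logSumExp ((N : ℝ) + 1) (a N) (b N) with hSdef
  have hN0 : ∀ N : ℕ, (0 : ℝ) < (N : ℝ) + 1 := fun N => by positivity
  have hS := fun N : ℕ => isTamePotential_logSumExp (hN0 N) (a N) (b N)
  have hSlow : ∀ N j, j ≤ N → ∀ x, V (y j) + inner ℝ (grad (y j)) (x - y j) ≤ S N x := by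
    intro N j hj x
    have := le_logSumExp (hN0 N) (a N) (b N) ⟨j, Nat.lt_succ_of_le hj⟩ x
    rwa [hl] at this
  have hSup : ∀ N x, S N x ≤ V x + Real.log ((N : ℝ) + 1) / ((N : ℝ) + 1) := by
    intro N x
    have := logSumExp_le (hN0 N) (a N) (b N) x (v := V x) fun i => by
      rw [hl]; exact htan _ _
    simpa using this
  have hlog : Tendsto (fun N : ℕ => Real.log ((N : ℝ) + 1) / ((N : ℝ) + 1)) atTop (𝓝 0) := by
    have h1 : Tendsto (fun x : ℝ => Real.log x / x) atTop (𝓝 0) :=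
      Real.isLittleO_log_id_atTop.tendsto_div_nhds_zero
    exact h1.comp (tendsto_atTop_add_const_right _ _ tendsto_natCast_atTop_atTop)
  have hSlim : ∀ x, Tendsto (fun N => S N x) atTop (𝓝 (V x)) := by
    intro x
    rw [tendsto_order]
    refine ⟨fun v hv => ?_, fun v hv => ?_⟩
    · have hc : Continuous fun z => V z + inner ℝ (grad z) (x - z) := by fun_prop
      have hopen := hc.isOpen_preimage _ (isOpen_Ioi (a := v))
      obtain ⟨j, hj⟩ := (TopologicalSpace.denseRange_denseSeq (Euc n)).exists_mem_open hopen
        ⟨x, by simpa using hv⟩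
      filter_upwards [eventually_ge_atTop j] with N hN
      exact lt_of_lt_of_le hj (hSlow N j hN x)
    · have h1 : Tendsto (fun N : ℕ => V x + Real.log ((N : ℝ) + 1) / ((N : ℝ) + 1)) atTop
          (𝓝 (V x)) := by simpa using hlog.const_add (V x)
      filter_upwards [h1.eventually_lt_const hv] with N hN
      exact (hSup N x).trans_lt hN
  set W : ℕ → Euc n → ℝ := fun N x => R / 2 * ‖x‖ ^ 2 + S N x with hW
  have hWc : ∀ N, Continuous (W N) := fun N => by
    have := (hS N).cont
    fun_prop
  -- The tangent at `y 0` lies below every `S N`, so one Gaussian function dominates all the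
  -- densities.
  set c₀ : ℝ := V (y 0) - inner ℝ (grad (y 0)) (y 0) with hc₀
  set A : ℝ := ‖grad (y 0)‖ with hA
  have hWlow : ∀ N x, Real.exp (-W N x) ≤
      Real.exp (-c₀ + A ^ 2 / R) * Real.exp (-(R / 4) * ‖x‖ ^ 2) := by
    intro N x
    rw [← Real.exp_add]
    refine Real.exp_le_exp.2 ?_
    have h1 := hSlow N 0 (Nat.zero_le _) x
    rw [inner_sub_right] at h1
    have h2 := (abs_le.1 (abs_real_inner_le_norm (grad (y 0)) x)).1
    have h3 : A * ‖x‖ ≤ R / 4 * ‖x‖ ^ 2 + A ^ 2 / R := by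
      have e : R / 4 * ‖x‖ ^ 2 + A ^ 2 / R - A * ‖x‖ = (R * ‖x‖ / 2 - A) ^ 2 / R := by
        field_simp; ring
      have : 0 ≤ (R * ‖x‖ / 2 - A) ^ 2 / R := by positivity
      linarith
    simp only [hW]
    linarith
  have hdomi : Integrable fun x : Euc n =>
      Real.exp (-c₀ + A ^ 2 / R) * Real.exp (-(R / 4) * ‖x‖ ^ 2) :=
    (integrable_exp_neg_mul_sq_norm (by positivity)).const_mul _
  have hWi : ∀ N, Integrable fun x => Real.exp (-W N x) := fun N =>
    hdomi.mono' (by have := hWc N; fun_prop) (Eventually.of_forall fun x => by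
      rw [Real.norm_of_nonneg (Real.exp_pos _).le]; exact hWlow N x)
  have hconv : ∀ φ : Euc n → ℝ, Continuous φ → (∃ C, ∀ x, |φ x| ≤ C) →
      Tendsto (fun N => ∫ x, φ x * Real.exp (-W N x)) atTop
        (𝓝 (∫ x, φ x * Real.exp (-U x))) := by
    rintro φ hφ ⟨C, hC⟩
    refine tendsto_integral_of_dominated_convergence
      (fun x => C * (Real.exp (-c₀ + A ^ 2 / R) * Real.exp (-(R / 4) * ‖x‖ ^ 2)))
      (fun N => by have := hWc N; exact Continuous.aestronglyMeasurable (by fun_prop))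
      (hdomi.const_mul C) (fun N => Eventually.of_forall fun x => ?_)
      (Eventually.of_forall fun x => ?_)
    · rw [norm_mul, Real.norm_of_nonneg (Real.exp_pos _).le]
      exact mul_le_mul (hC x) (hWlow N x) (Real.exp_pos _).le ((abs_nonneg _).trans (hC x))
    · have h1 : Tendsto (fun N => W N x) atTop (𝓝 (U x)) := by
        have := (hSlim x).const_add (R / 2 * ‖x‖ ^ 2)
        simpa [hV, hW] using this
      exact ((Real.continuous_exp.tendsto _).comp h1.neg).const_mul (φ x)
  set Z : ℕ → ℝ := fun N => ∫ x, Real.exp (-W N x) with hZ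
  have hZpos : ∀ N, 0 < Z N := fun N => integral_exp_pos (hWi N)
  have hZlim : Tendsto Z atTop (𝓝 1) := by
    have h1 := hconv (fun _ => 1) continuous_const ⟨1, fun _ => by simp⟩
    have h2 := integral_expNegMeasure hUc.measurable fun _ => (1 : ℝ)
    simp only [one_mul, integral_const, probReal_univ, smul_eq_mul] at h1 h2
    rwa [← h2] at h1
  -- Adding `log (Z N)` makes the approximating measures probability measures; since `Z N → 1`, the
  -- limit is unaffected.
  set W' : ℕ → Euc n → ℝ := fun N x => R / 2 * ‖x‖ ^ 2 + (S N x + Real.log (Z N)) with hW'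
  have hexpW' : ∀ N x, Real.exp (-W' N x) = (Z N)⁻¹ * Real.exp (-W N x) := by
    intro N x
    rw [show (Z N)⁻¹ = Real.exp (-Real.log (Z N)) by rw [Real.exp_neg, Real.exp_log (hZpos N)],
      ← Real.exp_add]
    congr 1
    simp only [hW', hW]
    ring
  have hprob' : ∀ N, IsProbabilityMeasure (expNegMeasure (W' N)) := fun N => by
    refine isProbabilityMeasure_expNegMeasure ?_ ?_
    · simp only [hexpW']; exact (hWi N).const_mul _
    · simp only [hexpW']
      rw [integral_const_mul]
      exact inv_mul_cancel₀ (hZpos N).ne'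
  have hW'c : ∀ N, Continuous (W' N) := fun N => by
    have := (hS N).cont
    fun_prop
  refine DualInequality.of_tendsto (l := atTop) (νs := fun N => expNegMeasure (W' N))
    (fun N => ?_) fun φ hφ hb => ?_
  · have := hprob' N
    exact ((hS N).add_const (Real.log (Z N))).dualInequality hR
  · rw [integral_expNegMeasure hUc.measurable]
    have h1 := (hZlim.inv₀ one_ne_zero).mul (hconv φ hφ hb)
    rw [inv_one, one_mul] at h1
    refine h1.congr fun N => ?_
    rw [integral_expNegMeasure (hW'c N).measurable, ← integral_const_mul]
    refine integral_congr_ae (Eventually.of_forall fun x => ?_)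
    simp only [hexpW']
    ring

/-! ### Pointwise algebra: Legendre duality and the comparison with Beckner's integrand. -/

/-- The optimal choice of the dual variable. -/
noncomputable def dualOptimizer (x z : ℝ) : ℝ := Real.sqrt ((x + Real.sqrt (x ^ 2 + z)) / 2)

section Algebra

variable {x z : ℝ}

theorem dualOptimizer_nonneg (x z : ℝ) : 0 ≤ dualOptimizer x z := Real.sqrt_nonneg _

theorem dualOptimizer_sq (hx : 0 ≤ x) : dualOptimizer x z ^ 2 = (x + Real.sqrt (x ^ 2 + z)) / 2 :=
  Real.sq_sqrt (by have := Real.sqrt_nonneg (x ^ 2 + z); positivity)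

theorem le_dualOptimizer_sq (hx : 0 ≤ x) (hz : 0 ≤ z) : x ≤ dualOptimizer x z ^ 2 := by
  rw [dualOptimizer_sq hx]
  have : x ≤ Real.sqrt (x ^ 2 + z) := Real.le_sqrt_of_sq_le (by linarith)
  linarith

/-- This is the critical point equation of `g ↦ x g - g³/3 - z/(4g)`. Writing `z` through `g` makes
all later estimates polynomial. -/
theorem eq_dualOptimizer (hx : 0 ≤ x) (hz : 0 ≤ z) :
    z = 4 * dualOptimizer x z ^ 2 * (dualOptimizer x z ^ 2 - x) := by
  rw [dualOptimizer_sq hx]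
  have := Real.sq_sqrt (by positivity : 0 ≤ x ^ 2 + z)
  linear_combination -this

theorem threeHalves_eq (hx : 0 ≤ x) :
    threeHalves x z = 3 * x * dualOptimizer x z - 2 * dualOptimizer x z ^ 3 := by
  have h1 : Real.sqrt (x + Real.sqrt (x ^ 2 + z)) = Real.sqrt 2 * dualOptimizer x z := by
    rw [dualOptimizer, ← Real.sqrt_mul (by norm_num)]
    congr 1
    ring
  have h2 : Real.sqrt (x ^ 2 + z) = 2 * dualOptimizer x z ^ 2 - x := by
    rw [dualOptimizer_sq hx]; ring
  rw [threeHalves, h1, h2]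
  have h3 : (0 : ℝ) < Real.sqrt 2 := by positivity
  field_simp
  ring

theorem rpow_three_halves_eq (hx : 0 ≤ x) : x ^ (3 / 2 : ℝ) = Real.sqrt x ^ 3 := by
  rw [Real.sqrt_eq_rpow, ← Real.rpow_natCast, ← Real.rpow_mul hx]
  norm_num

theorem sqrt_le_dualOptimizer (hx : 0 ≤ x) (hz : 0 ≤ z) : Real.sqrt x ≤ dualOptimizer x z :=
  (Real.sqrt_le_sqrt (le_dualOptimizer_sq hx hz)).trans_eq
    (Real.sqrt_sq (dualOptimizer_nonneg x z))

theorem rpow_sub_threeHalves_eq (hx : 0 ≤ x) :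
    x ^ (3 / 2 : ℝ) - threeHalves x z = (dualOptimizer x z - Real.sqrt x) *
      (2 * dualOptimizer x z ^ 2 + 2 * Real.sqrt x * dualOptimizer x z - Real.sqrt x ^ 2) := by
  rw [rpow_three_halves_eq hx, threeHalves_eq hx]
  have := Real.sq_sqrt hx
  linear_combination (3 * dualOptimizer x z) * this

theorem threeHalves_le_rpow (hx : 0 ≤ x) (hz : 0 ≤ z) : threeHalves x z ≤ x ^ (3 / 2 : ℝ) := by
  have h := rpow_sub_threeHalves_eq (z := z) hx
  have h1 := sqrt_le_dualOptimizer hx hz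
  have h2 := Real.sqrt_nonneg x
  have h3 : 0 ≤ (dualOptimizer x z - Real.sqrt x) *
      (2 * dualOptimizer x z ^ 2 + 2 * Real.sqrt x * dualOptimizer x z - Real.sqrt x ^ 2) :=
    mul_nonneg (by linarith) (by nlinarith)
  linarith

/-- The dual expression attains `threeHalves` at the optimizer. The shift by `ε` keeps the dual
variable away from zero, and the last term pays for the shift in the cube. -/
theorem threeHalves_le_dual (hx : 0 ≤ x) (hz : 0 ≤ z) {ε : ℝ} (hε : 0 < ε) :
    threeHalves x z ≤ 3 / 2 * (x * (dualOptimizer x z + ε) - (dualOptimizer x z + ε) ^ 3 / 3 -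
      z / (4 * (dualOptimizer x z + ε))) +
        1 / 2 * ((dualOptimizer x z + ε) ^ 3 - dualOptimizer x z ^ 3) := by
  rw [threeHalves_eq hx]
  have h1 := le_dualOptimizer_sq hx hz
  have h2 := eq_dualOptimizer hx hz
  have h3 := dualOptimizer_nonneg x z
  generalize dualOptimizer x z = g at *
  have h4 : z / (4 * (g + ε)) ≤ g * (g ^ 2 - x) := by
    rw [div_le_iff₀ (by positivity), h2]
    have : 0 ≤ g * (g ^ 2 - x) * ε := mul_nonneg (mul_nonneg h3 (by linarith)) hε.le
    nlinarith
  have h5 : 0 ≤ x * ε := by positivity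
  nlinarith

theorem abs_threeHalves_le (hx : 0 ≤ x) (hz : 0 ≤ z) :
    |threeHalves x z| ≤ 2 * dualOptimizer x z ^ 3 := by
  rw [threeHalves_eq hx]
  have h1 := le_dualOptimizer_sq hx hz
  have h3 := dualOptimizer_nonneg x z
  generalize dualOptimizer x z = g at *
  have h4 : x * g ≤ g ^ 2 * g := by gcongr
  have h5 : 0 ≤ x * g := by positivity
  have h6 : 0 ≤ g ^ 3 := by positivity
  rw [abs_le]
  constructor <;> nlinarith

/-- Either `g ≤ 2√x`, or the factored form of `x^(3/2) - threeHalves x z` is at least `g³`. It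
allows integrability of `threeHalves` to control `g³` in the cutoff argument. -/
theorem dualOptimizer_cube_le (hx : 0 ≤ x) :
    dualOptimizer x z ^ 3 ≤ 10 * Real.sqrt x ^ 3 + 2 * |threeHalves x z| := by
  have h := rpow_sub_threeHalves_eq (z := z) hx
  rw [rpow_three_halves_eq hx] at h
  have h3 := dualOptimizer_nonneg x z
  have h4 := Real.sqrt_nonneg x
  have h5 := neg_abs_le (threeHalves x z)
  have h6 := abs_nonneg (threeHalves x z)
  generalize dualOptimizer x z = g at *
  generalize Real.sqrt x = a at *
  rcases le_total g (2 * a) with h7 | h7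
  · have := pow_le_pow_left₀ h3 h7 3
    have h8 : 0 ≤ a ^ 3 := by positivity
    nlinarith
  · have h9 : g / 2 * (2 * g ^ 2) ≤ (g - a) * (2 * g ^ 2 + 2 * a * g - a ^ 2) :=
      mul_le_mul (by linarith) (by nlinarith) (by positivity) (by linarith)
    have h8 : 0 ≤ a ^ 3 := by positivity
    nlinarith

theorem sqrt_le_two_mul_dualOptimizer_sq (hx : 0 ≤ x) :
    Real.sqrt z ≤ 2 * dualOptimizer x z ^ 2 := by
  rw [dualOptimizer_sq hx]
  have : Real.sqrt z ≤ Real.sqrt (x ^ 2 + z) := Real.sqrt_le_sqrt (by nlinarith)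
  linarith

theorem dualOptimizer_sq_le (hx : 0 ≤ x) (hz : 0 ≤ z) :
    dualOptimizer x z ^ 2 ≤ x + Real.sqrt z / 2 := by
  rw [dualOptimizer_sq hx]
  have h1 : Real.sqrt (x ^ 2 + z) ≤ x + Real.sqrt z := by
    rw [Real.sqrt_le_left (by positivity)]
    have := Real.sq_sqrt hz
    nlinarith [mul_nonneg hx (Real.sqrt_nonneg z)]
  linarith

/-- With `a = √m`, the gap is `(G - a)² (G + 2a) / 2`. -/
theorem dual_le_rpow_three_halves {m G : ℝ} (hm : 0 ≤ m) (hG : 0 ≤ G) :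
    3 / 2 * (m * G - G ^ 3 / 3) ≤ m ^ (3 / 2 : ℝ) := by
  rw [rpow_three_halves_eq hm]
  have h1 := Real.sq_sqrt hm
  have h2 := Real.sqrt_nonneg m
  have h3 : 0 ≤ (G - Real.sqrt m) ^ 2 * (G + 2 * Real.sqrt m) := by positivity
  have h4 : Real.sqrt m ^ 2 * G = m * G := by rw [h1]
  nlinarith

theorem continuous_dualOptimizer {X : Type*} [TopologicalSpace X] {u v : X → ℝ}
    (hu : Continuous u) (hv : Continuous v) : Continuous fun p => dualOptimizer (u p) (v p) := by
  unfold dualOptimizer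
  fun_prop

theorem continuous_threeHalves {X : Type*} [TopologicalSpace X] {u v : X → ℝ}
    (hu : Continuous u) (hv : Continuous v) : Continuous fun p => threeHalves (u p) (v p) := by
  unfold threeHalves
  fun_prop

theorem becknerIntegrand_of_pos {y : ℝ} (hx : 0 < x) :
    becknerIntegrand x y = ENNReal.ofReal (3 / 8 * (Real.sqrt x)⁻¹ * y ^ 2) := by
  rw [becknerIntegrand, ENNReal.ofReal_rpow_of_pos hx, ← ENNReal.ofReal_mul (by norm_num),
    ← ENNReal.ofReal_mul (by positivity), Real.rpow_neg hx.le, ← Real.sqrt_eq_rpow]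

/-- With `a = √x` and `g` the optimizer, Beckner's term is `3 g² (g² - a²) / (2a)`, and `a` times
the gap is `(g - a)² (3g²/2 + a (g - a))`. This is positive because `y ≠ 0` forces `g > a`. -/
theorem rpow_sub_threeHalves_lt {y : ℝ} (hx : 0 < x) (hy : y ≠ 0) :
    x ^ (3 / 2 : ℝ) - threeHalves x (y ^ 2) < 3 / 8 * (Real.sqrt x)⁻¹ * y ^ 2 := by
  have hz : 0 < y ^ 2 := by positivity
  have h1 := le_dualOptimizer_sq hx.le hz.le
  have h2 := eq_dualOptimizer hx.le hz.le
  have h3 := dualOptimizer_nonneg x (y ^ 2)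
  have h4 := rpow_sub_threeHalves_eq (z := y ^ 2) hx.le
  rw [h4]
  have ha : 0 < Real.sqrt x := Real.sqrt_pos.2 hx
  have hax := Real.sq_sqrt hx.le
  generalize dualOptimizer x (y ^ 2) = g at *
  generalize Real.sqrt x = a at *
  have h5 : x < g ^ 2 := by
    refine lt_of_le_of_ne h1 fun h => ?_
    rw [← h, sub_self, mul_zero] at h2
    exact hz.ne' h2
  have h6 : a < g := by
    rw [← hax] at h5
    exact lt_of_pow_lt_pow_left₀ 2 h3 h5
  have h8 : 3 / 8 * a⁻¹ * y ^ 2 = (3 / 2 * g ^ 2 * (g ^ 2 - a ^ 2)) / a := by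
    rw [h2, ← hax]; field_simp; ring
  rw [h8, lt_div_iff₀ ha]
  have h7 : 0 < (g - a) ^ 2 * (3 / 2 * g ^ 2 + a * (g - a)) := by
    have : 0 < g - a := by linarith
    have : 0 < g := by linarith
    positivity
  nlinarith

theorem ofReal_le_becknerIntegrand {y : ℝ} (hx : 0 ≤ x) :
    ENNReal.ofReal (x ^ (3 / 2 : ℝ) - threeHalves x (y ^ 2)) ≤ becknerIntegrand x y ∧
      (y ≠ 0 →
        ENNReal.ofReal (x ^ (3 / 2 : ℝ) - threeHalves x (y ^ 2)) < becknerIntegrand x y) := by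
  have hlt : y ≠ 0 →
      ENNReal.ofReal (x ^ (3 / 2 : ℝ) - threeHalves x (y ^ 2)) < becknerIntegrand x y := by
    intro hy
    rcases hx.eq_or_lt with rfl | hx
    · have : becknerIntegrand 0 y = ⊤ := by
        rw [becknerIntegrand, ENNReal.ofReal_zero, ENNReal.zero_rpow_of_neg (by norm_num),
          ENNReal.mul_top (by simp), ENNReal.top_mul]
        simpa using hy
      rw [this]
      exact ENNReal.ofReal_lt_top
    · rw [becknerIntegrand_of_pos hx, ENNReal.ofReal_lt_ofReal_iff (by positivity)]
      exact rpow_sub_threeHalves_lt hx hy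
  refine ⟨?_, hlt⟩
  by_cases hy : y = 0
  · subst hy
    have h1 : dualOptimizer x (0 ^ 2) = Real.sqrt x := by
      rw [dualOptimizer]
      congr 1
      simp [Real.sqrt_sq hx]
    rw [rpow_sub_threeHalves_eq hx, h1]
    simp
  · exact (hlt hy).le

end Algebra

/-! ### From the dual inequality to the primal ones. -/

theorem norm_gradient_eq {n : ℕ} (f : Euc n → ℝ) (x : Euc n) :
    ‖gradient f x‖ = ‖fderiv ℝ f x‖ :=
  LinearIsometryEquiv.norm_map _ _

/-- The primal inequality for functions with bounded gradient. -/
theorem DualInequality.integral_threeHalves_le_of_bdd {n : ℕ} {ν : Measure (Euc n)}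
    [IsProbabilityMeasure ν] {R : ℝ} (hR : 0 < R) (hν : DualInequality ν fun _ => 1 / R)
    {f : Euc n → ℝ} (hf : ContDiff ℝ 1 f) (hf0 : ∀ x, 0 ≤ f x) (hfb : ∃ C, ∀ x, f x ≤ C)
    (hf' : ∃ C, ∀ x, ‖fderiv ℝ f x‖ ≤ C) :
    ∫ x, threeHalves (f x) (‖fderiv ℝ f x‖ ^ 2 / R) ∂ν ≤ (∫ x, f x ∂ν) ^ (3 / 2 : ℝ) := by
  obtain ⟨C, hC⟩ := hfb
  obtain ⟨C', hC'⟩ := hf'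
  have hC0 : 0 ≤ C := (hf0 0).trans (hC 0)
  have hC'0 : 0 ≤ C' := (norm_nonneg _).trans (hC' 0)
  have hdc : Continuous (fderiv ℝ f) := hf.continuous_fderiv (by norm_num)
  have hfc := hf.continuous
  set z : Euc n → ℝ := fun x => ‖fderiv ℝ f x‖ ^ 2 / R with hz
  have hzc : Continuous z := by fun_prop
  have hz0 : ∀ x, 0 ≤ z x := fun x => by positivity
  set g : Euc n → ℝ := fun x => dualOptimizer (f x) (z x) with hg
  have hgc : Continuous g := continuous_dualOptimizer hfc hzc
  have hg0 : ∀ x, 0 ≤ g x := fun x => dualOptimizer_nonneg _ _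
  obtain ⟨b, hb0, hb⟩ : ∃ b, 0 ≤ b ∧ ∀ x, g x ≤ b := by
    refine ⟨Real.sqrt (C + Real.sqrt (C' ^ 2 / R) / 2), Real.sqrt_nonneg _, fun x => ?_⟩
    refine Real.le_sqrt_of_sq_le ((dualOptimizer_sq_le (hf0 x) (hz0 x)).trans ?_)
    have : z x ≤ C' ^ 2 / R := by
      simp only [hz]
      gcongr
      exact hC' x
    have h2 := Real.sqrt_le_sqrt this
    linarith [hC x]
  have hMc : Continuous fun x => threeHalves (f x) (z x) := continuous_threeHalves hfc hzc
  have hMi : Integrable (fun x => threeHalves (f x) (z x)) ν :=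
    integrable_of_continuous_bdd hMc ⟨2 * b ^ 3, fun x =>
      (abs_threeHalves_le (hf0 x) (hz0 x)).trans (by have := hg0 x; have := hb x; gcongr)⟩
  set m := ∫ x, f x ∂ν with hm
  have hm0 : 0 ≤ m := integral_nonneg hf0
  have key : ∀ ε, 0 < ε → ε ≤ 1 →
      ∫ x, threeHalves (f x) (z x) ∂ν ≤ m ^ (3 / 2 : ℝ) + ε * (3 * b ^ 2 + 3 * b + 1) := by
    intro ε hε hε1
    -- The optimizer itself may vanish where `f` and its gradient do, so it is shifted by `ε`.
    have hpair : IsTestPair f fun x => g x + ε :=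
      { contDiff := hf
        bdd := ⟨C, fun x => by rw [abs_of_nonneg (hf0 x)]; exact hC x⟩
        fderiv_bdd := ⟨C', hC'⟩
        cont := hgc.add continuous_const
        lower := ⟨ε, hε, fun x => by linarith [hg0 x]⟩
        upper := ⟨b + ε, fun x => by linarith [hb x]⟩ }
    have hDi : Integrable (dualIntegrand (fun _ => 1 / R) f fun x => g x + ε) ν :=
      integrable_of_continuous_bdd (hpair.continuous_dualIntegrand _) (hpair.dualIntegrand_bdd _)
    have hpt : ∀ x, threeHalves (f x) (z x) ≤
        3 / 2 * dualIntegrand (fun _ => 1 / R) f (fun x => g x + ε) x +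
          ε * (3 * b ^ 2 + 3 * b + 1) := by
      intro x
      have h1 := threeHalves_le_dual (hf0 x) (hz0 x) hε
      have h2 : ∑ i, 1 / R * partialDeriv f i x ^ 2 = z x := by
        rw [← Finset.mul_sum, sum_partialDeriv_sq]
        simp only [hz]
        ring
      have h3 : (g x + ε) ^ 3 - g x ^ 3 ≤ ε * (3 * b ^ 2 + 3 * b + 1) := by
        have e : (g x + ε) ^ 3 - g x ^ 3 = ε * (3 * g x ^ 2 + 3 * g x * ε + ε ^ 2) := by ring
        rw [e]
        have h4 : g x ^ 2 ≤ b ^ 2 := pow_le_pow_left₀ (hg0 x) (hb x) 2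
        have h5 : g x * ε ≤ b * 1 := mul_le_mul (hb x) hε1 hε.le hb0
        have h6 : ε ^ 2 ≤ 1 := pow_le_one₀ hε.le hε1
        refine mul_le_mul_of_nonneg_left ?_ hε.le
        linarith
      have h7 : 0 ≤ ε * (3 * b ^ 2 + 3 * b + 1) := by positivity
      rw [dualIntegrand, h2]
      change _ ≤ 3 / 2 * (f x * (g x + ε) - (g x + ε) ^ 3 / 3 - z x / (4 * (g x + ε))) +
        1 / 2 * ((g x + ε) ^ 3 - g x ^ 3) at h1
      linarith
    refine (integral_mono hMi ((hDi.const_mul _).add (integrable_const _)) hpt).trans ?_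
    simp only [Pi.add_apply]
    rw [integral_add (hDi.const_mul _) (integrable_const _), integral_const_mul]
    have h1 := mul_le_mul_of_nonneg_left (hν _ _ hpair) (by norm_num : (0 : ℝ) ≤ 3 / 2)
    have hG0 : 0 ≤ ∫ x, (g x + ε) ∂ν := integral_nonneg fun x => (hpair.pos x).le
    have h2 := dual_le_rpow_three_halves hm0 hG0
    have h3 : ∫ _x, ε * (3 * b ^ 2 + 3 * b + 1) ∂ν = ε * (3 * b ^ 2 + 3 * b + 1) := by simp
    rw [h3]
    linarith
  refine le_of_forall_pos_le_add fun δ hδ => ?_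
  have hK : 0 < 3 * b ^ 2 + 3 * b + 1 := by positivity
  refine (key (min 1 (δ / (3 * b ^ 2 + 3 * b + 1))) (by positivity) (min_le_left _ _)).trans ?_
  have := mul_le_mul_of_nonneg_right (min_le_right 1 (δ / (3 * b ^ 2 + 3 * b + 1))) hK.le
  rw [div_mul_cancel₀ _ hK.ne'] at this
  linarith

/-- Smooth cutoffs with uniformly bounded gradients. -/
theorem exists_cutoff (n : ℕ) : ∃ (χ : ℕ → Euc n → ℝ) (B : ℝ), ∀ k, ContDiff ℝ ∞ (χ k) ∧
    HasCompactSupport (χ k) ∧ (∀ x, 0 ≤ χ k x ∧ χ k x ≤ 1) ∧ (∀ x, ‖fderiv ℝ (χ k) x‖ ≤ B) ∧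
    ∀ x, ‖x‖ < (k : ℝ) + 1 → χ k =ᶠ[𝓝 x] 1 := by
  let β : ContDiffBump (0 : Euc n) := ⟨1, 2, one_pos, one_lt_two⟩
  have hβ : ContDiff ℝ ∞ β := β.contDiff
  obtain ⟨B, hB⟩ := (hβ.continuous_fderiv (by simp)).bounded_above_of_compact_support
    (β.hasCompactSupport.fderiv ℝ)
  have hB0 : 0 ≤ B := (norm_nonneg _).trans (hB 0)
  refine ⟨fun k x => β (((k : ℝ) + 1)⁻¹ • x), B, fun k => ?_⟩
  have hk : (0 : ℝ) < (k : ℝ) + 1 := by positivity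
  refine ⟨hβ.comp (contDiff_const_smul _), ?_, fun x => ⟨β.nonneg, β.le_one⟩, fun x => ?_,
    fun x hx => ?_⟩
  · exact β.hasCompactSupport.comp_homeomorph (Homeomorph.smulOfNeZero _ (inv_pos.2 hk).ne')
  · have h1 := ((hβ.differentiable (by simp)) (((k : ℝ) + 1)⁻¹ • x)).hasFDerivAt.comp x
      ((hasFDerivAt_id x).const_smul (((k : ℝ) + 1)⁻¹))
    have h2 : fderiv ℝ (fun x => β (((k : ℝ) + 1)⁻¹ • x)) x = _ := h1.fderiv
    rw [h2, ContinuousLinearMap.comp_smul, ContinuousLinearMap.comp_id, norm_smul,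
      Real.norm_of_nonneg (inv_pos.2 hk).le]
    refine (mul_le_of_le_one_left (norm_nonneg _) ?_).trans (hB _)
    exact inv_le_one_of_one_le₀ (by linarith [(Nat.cast_nonneg k : (0 : ℝ) ≤ k)])
  · have hopen : IsOpen {x : Euc n | ‖x‖ < (k : ℝ) + 1} :=
      isOpen_lt continuous_norm continuous_const
    filter_upwards [hopen.mem_nhds hx] with y hy
    refine β.one_of_mem_closedBall ?_
    rw [mem_closedBall_zero_iff, norm_smul, Real.norm_of_nonneg (inv_pos.2 hk).le,
      inv_mul_le_iff₀ hk, mul_one]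
    exact le_of_lt hy

/-- The primal inequality whenever the left-hand side is integrable. -/
theorem DualInequality.integral_threeHalves_le {n : ℕ} {ν : Measure (Euc n)}
    [IsProbabilityMeasure ν] {R : ℝ} (hR : 0 < R) (hν : DualInequality ν fun _ => 1 / R)
    {f : Euc n → ℝ} (hf : ContDiff ℝ ∞ f) (hf0 : ∀ x, 0 ≤ f x) (hfb : ∃ C, ∀ x, f x ≤ C)
    (hint : Integrable (fun x => threeHalves (f x) (‖fderiv ℝ f x‖ ^ 2 / R)) ν) :
    ∫ x, threeHalves (f x) (‖fderiv ℝ f x‖ ^ 2 / R) ∂ν ≤ (∫ x, f x ∂ν) ^ (3 / 2 : ℝ) := by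
  obtain ⟨C, hC⟩ := hfb
  have hC0 : 0 ≤ C := (hf0 0).trans (hC 0)
  obtain ⟨χ, B, hχ⟩ := exists_cutoff n
  have hB0 : 0 ≤ B := (norm_nonneg _).trans ((hχ 0).2.2.2.1 0)
  have hfd : Differentiable ℝ f := hf.differentiable (by simp)
  set F : ℕ → Euc n → ℝ := fun k x => χ k x * f x with hF
  have hFs : ∀ k, ContDiff ℝ ∞ (F k) := fun k => (hχ k).1.mul hf
  have hF0 : ∀ k x, 0 ≤ F k x := fun k x => mul_nonneg ((hχ k).2.2.1 x).1 (hf0 x)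
  have hFf : ∀ k x, F k x ≤ f x := fun k x => mul_le_of_le_one_left (hf0 x) ((hχ k).2.2.1 x).2
  have hF' : ∀ k x, ‖fderiv ℝ (F k) x‖ ≤ ‖fderiv ℝ f x‖ + C * B := by
    intro k x
    have h1 := (((hχ k).1.differentiable (by simp)) x).hasFDerivAt.mul (hfd x).hasFDerivAt
    have h2 : fderiv ℝ (F k) x = χ k x • fderiv ℝ f x + f x • fderiv ℝ (χ k) x := h1.fderiv
    rw [h2]
    refine (norm_add_le _ _).trans (add_le_add ?_ ?_)
    · rw [norm_smul, Real.norm_of_nonneg ((hχ k).2.2.1 x).1]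
      exact mul_le_of_le_one_left (norm_nonneg _) ((hχ k).2.2.1 x).2
    · rw [norm_smul, Real.norm_of_nonneg (hf0 x)]
      exact mul_le_mul (hC x) ((hχ k).2.2.2.1 x) (norm_nonneg _) hC0
  have hFcs : ∀ k, HasCompactSupport (F k) := fun k => (hχ k).2.1.mul_right
  have hFd : ∀ k, Continuous (fderiv ℝ (F k)) := fun k => (hFs k).continuous_fderiv (by simp)
  have hFlocal : ∀ x, ∀ᶠ k : ℕ in atTop, F k x = f x ∧ fderiv ℝ (F k) x = fderiv ℝ f x := by
    intro x
    obtain ⟨k₀, hk₀⟩ := exists_nat_gt ‖x‖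
    filter_upwards [eventually_ge_atTop k₀] with k hk
    have h1 := (hχ k).2.2.2.2 x (by
      have : (k₀ : ℝ) ≤ k := by exact_mod_cast hk
      linarith)
    have h2 : F k =ᶠ[𝓝 x] f := by
      filter_upwards [h1] with y hy
      simp [hF, hy]
    exact ⟨h2.self_of_nhds, h2.fderiv_eq⟩
  have hmain : ∀ k, ∫ x, threeHalves (F k x) (‖fderiv ℝ (F k) x‖ ^ 2 / R) ∂ν ≤
      (∫ x, F k x ∂ν) ^ (3 / 2 : ℝ) := fun k =>
    hν.integral_threeHalves_le_of_bdd hR ((hFs k).of_le (by simp)) (hF0 k)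
      ⟨C, fun x => (hFf k x).trans (hC x)⟩
      ((hFd k).bounded_above_of_compact_support ((hFcs k).fderiv ℝ))
  -- `D²` collects the bound on `f` and the gradient of the cutoff in the bound for the squared
  -- optimizer of `F k`, so that this optimizer is at most `D + g`, uniformly in `k`.
  set D := Real.sqrt (C + C * B / (2 * Real.sqrt R)) with hD
  have hD0 : 0 ≤ D := Real.sqrt_nonneg _
  have hdom : ∀ k x, |threeHalves (F k x) (‖fderiv ℝ (F k) x‖ ^ 2 / R)| ≤
      8 * (D ^ 3 + (10 * Real.sqrt C ^ 3 +
        2 * |threeHalves (f x) (‖fderiv ℝ f x‖ ^ 2 / R)|)) := by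
    intro k x
    have hsq : ∀ v : ℝ, 0 ≤ v → Real.sqrt (v ^ 2 / R) = v / Real.sqrt R := fun v hv => by
      rw [Real.sqrt_div (sq_nonneg _), Real.sqrt_sq hv]
    have hz : 0 ≤ ‖fderiv ℝ f x‖ ^ 2 / R := by positivity
    have hzk : 0 ≤ ‖fderiv ℝ (F k) x‖ ^ 2 / R := by positivity
    have h1 := abs_threeHalves_le (hF0 k x) hzk
    have h2 := dualOptimizer_sq_le (hF0 k x) hzk
    have h3 := sqrt_le_two_mul_dualOptimizer_sq (z := ‖fderiv ℝ f x‖ ^ 2 / R) (hf0 x)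
    have h4 := dualOptimizer_cube_le (z := ‖fderiv ℝ f x‖ ^ 2 / R) (hf0 x)
    rw [hsq _ (norm_nonneg _)] at h2 h3
    have hg0 := dualOptimizer_nonneg (f x) (‖fderiv ℝ f x‖ ^ 2 / R)
    have hgk0 := dualOptimizer_nonneg (F k x) (‖fderiv ℝ (F k) x‖ ^ 2 / R)
    set g := dualOptimizer (f x) (‖fderiv ℝ f x‖ ^ 2 / R)
    set gk := dualOptimizer (F k x) (‖fderiv ℝ (F k) x‖ ^ 2 / R)
    have hRs : 0 < Real.sqrt R := Real.sqrt_pos.2 hR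
    have h5 : ‖fderiv ℝ (F k) x‖ / Real.sqrt R ≤
        ‖fderiv ℝ f x‖ / Real.sqrt R + C * B / Real.sqrt R := by
      rw [← add_div]
      exact div_le_div_of_nonneg_right (hF' k x) hRs.le
    have h6 : D ^ 2 = C + C * B / (2 * Real.sqrt R) := Real.sq_sqrt (by positivity)
    have h7 : C * B / (2 * Real.sqrt R) = C * B / Real.sqrt R / 2 := by
      field_simp
    have h8 : gk ^ 2 ≤ (D + g) ^ 2 := by
      have := (hFf k x).trans (hC x)
      have h9 : 0 ≤ D * g := by positivity
      nlinarith
    have h9 : gk ≤ D + g := le_of_sq_le_sq h8 (by positivity)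
    have h10 : gk ^ 3 ≤ 4 * (D ^ 3 + g ^ 3) := by
      refine (pow_le_pow_left₀ hgk0 h9 3).trans ?_
      have : 0 ≤ (D + g) * (D - g) ^ 2 := by positivity
      nlinarith
    have h11 : Real.sqrt (f x) ^ 3 ≤ Real.sqrt C ^ 3 :=
      pow_le_pow_left₀ (Real.sqrt_nonneg _) (Real.sqrt_le_sqrt (hC x)) 3
    linarith
  have hlimM : Tendsto (fun k => ∫ x, threeHalves (F k x) (‖fderiv ℝ (F k) x‖ ^ 2 / R) ∂ν) atTop
      (𝓝 (∫ x, threeHalves (f x) (‖fderiv ℝ f x‖ ^ 2 / R) ∂ν)) := by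
    refine tendsto_integral_of_dominated_convergence _
      (fun k => (continuous_threeHalves (hFs k).continuous
        (by have := hFd k; fun_prop)).aestronglyMeasurable)
      (((integrable_const _).add ((integrable_const _).add (hint.abs.const_mul 2))).const_mul 8)
      (fun k => Eventually.of_forall fun x => hdom k x) (Eventually.of_forall fun x => ?_)
    refine tendsto_const_nhds.congr' ?_
    filter_upwards [hFlocal x] with k hk
    rw [hk.1, hk.2]
  have hlimf : Tendsto (fun k => ∫ x, F k x ∂ν) atTop (𝓝 (∫ x, f x ∂ν)) := by
    refine tendsto_integral_of_dominated_convergence (fun _ => C)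
      (fun k => (hFs k).continuous.aestronglyMeasurable) (integrable_const _)
      (fun k => Eventually.of_forall fun x => ?_) (Eventually.of_forall fun x => ?_)
    · rw [Real.norm_of_nonneg (hF0 k x)]
      exact (hFf k x).trans (hC x)
    · refine tendsto_const_nhds.congr' ?_
      filter_upwards [hFlocal x] with k hk
      rw [hk.1]
  have hpow : Tendsto (fun k => (∫ x, F k x ∂ν) ^ (3 / 2 : ℝ)) atTop
      (𝓝 ((∫ x, f x ∂ν) ^ (3 / 2 : ℝ))) :=
    ((Real.continuousAt_rpow_const _ _ (Or.inr (by norm_num))).tendsto).comp hlimf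
  exact le_of_tendsto_of_tendsto' hlimM hpow hmain

theorem integrable_of_lintegral_ofReal {X : Type*} [MeasurableSpace X] {ν : Measure X}
    {φ : X → ℝ} (hφ : AEStronglyMeasurable φ ν) (h1 : ∫⁻ x, ENNReal.ofReal (φ x) ∂ν ≠ ⊤)
    (h2 : ∫⁻ x, ENNReal.ofReal (-φ x) ∂ν ≠ ⊤) : Integrable φ ν := by
  refine ⟨hφ, ?_⟩
  have h3 : ∫⁻ x, ‖φ x‖ₑ ∂ν ≤
      ∫⁻ x, (ENNReal.ofReal (φ x) + ENNReal.ofReal (-φ x)) ∂ν := by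
    refine lintegral_mono fun x => ?_
    rw [Real.enorm_eq_ofReal_abs]
    rcases le_total 0 (φ x) with h | h
    · rw [abs_of_nonneg h]; exact le_self_add
    · rw [abs_of_nonpos h]; exact le_add_self
  refine h3.trans_lt ?_
  rw [lintegral_add_left' hφ.aemeasurable.ennreal_ofReal]
  exact ENNReal.add_lt_top.2 ⟨h1.lt_top, h2.lt_top⟩

theorem DualInequality.extIntegral_threeHalves_le {n : ℕ} {ν : Measure (Euc n)}
    [IsProbabilityMeasure ν] {R : ℝ} (hR : 0 < R) (hν : DualInequality ν fun _ => 1 / R)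
    {f : Euc n → ℝ} (hf : ContDiff ℝ ∞ f) (hf0 : ∀ x, 0 ≤ f x) (hfb : ∃ C, ∀ x, f x ≤ C) :
    ∫⁻ x, ENNReal.ofReal (threeHalves (f x) (‖gradient f x‖ ^ 2 / R)) ∂ν < ⊤ ∧
      extIntegral ν (fun x => threeHalves (f x) (‖gradient f x‖ ^ 2 / R)) ≤
        (((∫ x, f x ∂ν) ^ (3 / 2 : ℝ) : ℝ) : EReal) := by
  simp only [norm_gradient_eq]
  have hdc : Continuous (fderiv ℝ f) := hf.continuous_fderiv (by simp)
  have hMc : Continuous fun x => threeHalves (f x) (‖fderiv ℝ f x‖ ^ 2 / R) :=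
    continuous_threeHalves hf.continuous (by fun_prop)
  have hpos : ∫⁻ x, ENNReal.ofReal (threeHalves (f x) (‖fderiv ℝ f x‖ ^ 2 / R)) ∂ν < ⊤ := by
    obtain ⟨C, hC⟩ := hfb
    refine (lintegral_mono (g := fun _ => ENNReal.ofReal (C ^ (3 / 2 : ℝ))) fun x =>
      ENNReal.ofReal_le_ofReal ((threeHalves_le_rpow (hf0 x) (by positivity)).trans
        (Real.rpow_le_rpow (hf0 x) (hC x) (by norm_num)))).trans_lt ?_
    simp
  refine ⟨hpos, ?_⟩
  -- The positive part is finite, so if the negative part is not, the left-hand side is `-∞`;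
  -- otherwise the integrand is integrable.
  by_cases hneg : ∫⁻ x, ENNReal.ofReal (-threeHalves (f x) (‖fderiv ℝ f x‖ ^ 2 / R)) ∂ν = ⊤
  · rw [extIntegral, hneg]
    simp
  · have hint := integrable_of_lintegral_ofReal hMc.aestronglyMeasurable hpos.ne hneg
    rw [extIntegral_eq_integral hint]
    exact EReal.coe_le_coe_iff.2 (hν.integral_threeHalves_le hR hf hf0 hfb hint)

theorem DualInequality.ofReal_deficit_le {n : ℕ} {ν : Measure (Euc n)}
    [IsProbabilityMeasure ν] (hν : DualInequality ν fun _ => 1)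
    {f : Euc n → ℝ} (hf : ContDiff ℝ ∞ f) (hf0 : ∀ x, 0 ≤ f x) (hfb : ∃ C, ∀ x, f x ≤ C) :
    ENNReal.ofReal ((∫ x, (f x) ^ (3 / 2 : ℝ) ∂ν) - (∫ x, f x ∂ν) ^ (3 / 2 : ℝ)) ≤
      ∫⁻ x, ENNReal.ofReal ((f x) ^ (3 / 2 : ℝ) - threeHalves (f x) (‖gradient f x‖ ^ 2)) ∂ν := by
  simp only [norm_gradient_eq]
  have hdc : Continuous (fderiv ℝ f) := hf.continuous_fderiv (by simp)
  have hMc : Continuous fun x => threeHalves (f x) (‖fderiv ℝ f x‖ ^ 2) :=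
    continuous_threeHalves hf.continuous (by fun_prop)
  have hpc : Continuous fun x => (f x) ^ (3 / 2 : ℝ) :=
    hf.continuous.rpow_const fun x => Or.inr (by norm_num)
  have hpi : Integrable (fun x => (f x) ^ (3 / 2 : ℝ)) ν := by
    obtain ⟨C, hC⟩ := hfb
    refine integrable_of_continuous_bdd hpc ⟨C ^ (3 / 2 : ℝ), fun x => ?_⟩
    rw [abs_of_nonneg (Real.rpow_nonneg (hf0 x) _)]
    exact Real.rpow_le_rpow (hf0 x) (hC x) (by norm_num)
  have hnn : ∀ x, 0 ≤ (f x) ^ (3 / 2 : ℝ) - threeHalves (f x) (‖fderiv ℝ f x‖ ^ 2) := fun x =>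
    sub_nonneg.2 (threeHalves_le_rpow (hf0 x) (by positivity))
  -- If the right-hand side is finite, then `threeHalves` is integrable, being the difference of the
  -- integrable `f^(3/2)` and the integrable deficit.
  by_cases htop : ∫⁻ x, ENNReal.ofReal
      ((f x) ^ (3 / 2 : ℝ) - threeHalves (f x) (‖fderiv ℝ f x‖ ^ 2)) ∂ν = ⊤
  · rw [htop]; exact le_top
  · have hdi : Integrable
        (fun x => (f x) ^ (3 / 2 : ℝ) - threeHalves (f x) (‖fderiv ℝ f x‖ ^ 2)) ν :=
      integrable_of_lintegral_ofReal (hpc.sub hMc).aestronglyMeasurable htop (by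
        simp only [ENNReal.ofReal_of_nonpos (neg_nonpos.2 (hnn _))]; simp)
    have hMi : Integrable (fun x => threeHalves (f x) (‖fderiv ℝ f x‖ ^ 2 / 1)) ν := by
      refine (hpi.sub hdi).congr (Eventually.of_forall fun x => ?_)
      simp
    have h1 := DualInequality.integral_threeHalves_le one_pos (by simpa using hν) hf hf0 hfb hMi
    simp only [div_one] at h1 hMi
    rw [← ofReal_integral_eq_lintegral_ofReal hdi (Eventually.of_forall hnn),
      integral_sub hpi hMi]
    exact ENNReal.ofReal_le_ofReal (by linarith)

theorem mainTheorem7 (n : ℕ) (f : EuclideanSpace ℝ (Fin n) → ℝ)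
    (hf : ContDiff ℝ ∞ f) (hf_nonneg : ∀ x, 0 ≤ f x) (hf_bdd : ∃ C : ℝ, ∀ x, f x ≤ C) :
    -- the inequality for uniformly log-concave probability measures
    (∀ (R : ℝ), 0 < R → ∀ (U : EuclideanSpace ℝ (Fin n) → ℝ), ContDiff ℝ ∞ U → HessianGE U R →
      IsProbabilityMeasure (expNegMeasure U) →
        (∫⁻ x, ENNReal.ofReal (threeHalves (f x) (‖gradient f x‖ ^ 2 / R)) ∂(expNegMeasure U) < ⊤) ∧
        extIntegral (expNegMeasure U) (fun x => threeHalves (f x) (‖gradient f x‖ ^ 2 / R)) ≤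
          (((∫ x, f x ∂(expNegMeasure U)) ^ (3 / 2 : ℝ) : ℝ) : EReal)) ∧
    -- its form for the Gaussian measure; the integrand on the right is nonnegative
    (∀ x, 0 ≤ (f x) ^ (3 / 2 : ℝ) - threeHalves (f x) (‖gradient f x‖ ^ 2)) ∧
    ENNReal.ofReal ((∫ x, (f x) ^ (3 / 2 : ℝ) ∂(gaussianMeasure n)) -
        (∫ x, f x ∂(gaussianMeasure n)) ^ (3 / 2 : ℝ)) ≤
      ∫⁻ x, ENNReal.ofReal ((f x) ^ (3 / 2 : ℝ) - threeHalves (f x) (‖gradient f x‖ ^ 2))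
        ∂(gaussianMeasure n) ∧
    -- it improves Beckner's bound, also pointwise, and strictly so where the gradient is nonzero
    (∫⁻ x, ENNReal.ofReal ((f x) ^ (3 / 2 : ℝ) - threeHalves (f x) (‖gradient f x‖ ^ 2))
        ∂(gaussianMeasure n) ≤
      ∫⁻ x, becknerIntegrand (f x) ‖gradient f x‖ ∂(gaussianMeasure n)) ∧
    (∀ x y : ℝ, 0 ≤ x → 0 ≤ y →
      ENNReal.ofReal (x ^ (3 / 2 : ℝ) - threeHalves x (y ^ 2)) ≤ becknerIntegrand x y ∧
      (y ≠ 0 →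
        ENNReal.ofReal (x ^ (3 / 2 : ℝ) - threeHalves x (y ^ 2)) < becknerIntegrand x y)) := by
  refine ⟨fun R hR U hU hH hprob => ?_, fun x => ?_, ?_, ?_, fun x y hx _ =>
    ofReal_le_becknerIntegrand hx⟩
  · exact (dualInequality_expNegMeasure hR hU hH).extIntegral_threeHalves_le hR hf hf_nonneg
      hf_bdd
  · exact sub_nonneg.2 (threeHalves_le_rpow (hf_nonneg x) (by positivity))
  · rw [gaussianMeasure_eq_stdGaussian]
    exact (dualInequality_stdGaussian n).ofReal_deficit_le hf hf_nonneg hf_bdd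
  · exact lintegral_mono fun x => (ofReal_le_becknerIntegrand (hf_nonneg x)).1
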